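/- Let $k$ be an algebraically closed field of characteristic zero, $\mathfrak g=\mathfrak{sl}_2(k)$ with standard basis $e,f,h$, and $\mathcal A=k[t,t^{-1}]$. Let $\hat{\mathfrak g}=\mathfrak g\otimes\mathcal A$ be the loop algebra and $\tilde{\mathfrak g}=\hat{\mathfrak g}\oplus k\,d$ the centreless affine Lie algebra, where $[d,x\otimes t^n]=n\,x\otimes t^n$. A function $\varphi:\mathbb Z\to k$ is exponential-polynomial if it is a linear combination of functions $m\mapsto m^j\lambda^m$ with $j\ge 0$ and $\lambda\in k^\times$. If such a $\varphi$ is non-zero, then the additive monoid generated by its support is $r\mathbb Z$ for a unique positive integer $r=\deg\varphi$. Let $L(\varphi)$ be the unique irreducible quotient of the $\hat{\mathfrak g}$-module induced from the one-dimensional $(ke\oplus kh)\otimes\mathcal A$-module $k v_\varphi$ on which $h\otimes t^m$ acts by $\varphi(m)$ and $e\otimes\mathcal A$ acts by zero. Let $H(\varphi)\subseteq\mathcal A$ be the submodule generated by $1$ for the action $h\otimes t^m\cdot t^n=\varphi(m)t^{m+n}$, $d\cdot t^n=n t^n$ of $h\otimes\mathcal A\oplus kd$; let $e\otimes\mathcal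 A$ act on it by zero, and let $\tilde L(\varphi)$ be the unique irreducible quotient of the $\tilde{\mathfrak g}$-module induced from $H(\varphi)$. For $\gamma\in k$ let $k_\gamma$ be the one-dimensional $\tilde{\mathfrak g}$-module on which $\hat{\mathfrak g}$ acts by zero and $d$ by $\gamma$. For a $\hat{\mathfrak g}$-module $M$, the loop module $\mathcal L(M)=M\otimes\mathcal A$ is the $\tilde{\mathfrak g}$-module with $(x\otimes t^m)\cdot(v\otimes t^n)=((x\otimes t^m)v)\otimes t^{m+n}$ and $d\cdot(v\otimes t^n)=n\,v\otimes t^n$. Let $\varphi$ be a non-zero exponential-polynomial function, $r=\deg\varphi$, and $\zeta\in k$ a primitive $r$-th root of unity. Let $\eta$ be the linear automorphism of $L(\varphi)$ determined by $\eta(v_\varphi)=v_\varphi$ and $\eta((x\otimes a(t))\cdot w)=(x\otimes a(\zeta^{-1}t))\cdot\eta(w)$ for $x\in\mathfrak g$, $a\in\mathcal A$, $w\in L(\varphi)$; and let $\hat\eta$ be the linear map on $\mathcal L(L(\varphi))$ with $\hat\eta(u\otimes a(t))=\eta(u)\otimes a(\zeta t)$. For an endomorphism $\theta$ of a vector space $V$,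 write $V^\theta_\lambda=\{v\in V:\theta(v)=\lambda v\}$. Then: (1) $\hat\eta$ is an automorphism of the $\tilde{\mathfrak g}$-module $\mathcal L(L(\varphi))$, of order $r$. (2) $\mathcal L(L(\varphi))=\bigoplus_{i\in\mathbb Z/r}\mathcal L(L(\varphi))^{\hat\eta}_{\zeta^i}$, and $\mathcal L(L(\varphi))^{\hat\eta}_{\zeta^i}=\bigoplus_{m\in\mathbb Z}L(\varphi)^{\eta}_{\zeta^{i-m}}\otimes t^m$ for every $i$. (3) For every integer $i$, the eigenspace $\mathcal L(L(\varphi))^{\hat\eta}_{\zeta^i}$ is a $\tilde{\mathfrak g}$-submodule isomorphic to $\tilde L(\varphi)\otimes k_i$; in particular it is irreducible. -/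

import Mathlib

open scoped TensorProduct LaurentPolynomial

namespace LoopSl2

noncomputable section

/-! ### Exponential-polynomial functions and their degree -/

section ExpPoly

variable (k : Type*) [Field k]

/-- The function `m ↦ m ^ j * lam ^ m` on the integers. -/
def expMonomial (lam : kˣ) (j : ℕ) : ℤ → k := fun m => (m : k) ^ j * ((lam ^ m : kˣ) : k)

/-- The space of exponential-polynomial functions `ℤ → k`: the finite sums of products of
polynomial functions and exponential functions `m ↦ lam ^ m`, with `lam ≠ 0`. -/
def expPoly : Submodule k (ℤ → k) :=
  Submodule.span k (Set.range fun p : kˣ × ℕ => expMonomial k p.1 p.2)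

variable {k}

/-- The degree of `φ`: the integer `r` such that the additive monoid generated by the support
of `φ` is `r ℤ` (it exists, is unique and is positive if `φ` is a non-zero exponential-polynomial
function, see `degree_spec`). -/
def degree (φ : ℤ → k) : ℕ :=
  sInf {r : ℕ | AddSubmonoid.closure (Function.support φ) =
    (AddSubgroup.zmultiples (r : ℤ)).toAddSubmonoid}

/-- The shift `f ↦ f (· + s)`. -/
def shift (s : ℤ) : (ℤ → k) →ₗ[k] (ℤ → k) := LinearMap.funLeft k k (fun m => m + s)

theorem exists_shift_stable {φ : ℤ → k} (hφ : φ ∈ expPoly k) :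
    ∃ W : Submodule k (ℤ → k), FiniteDimensional k W ∧ φ ∈ W ∧
      ∀ s : ℤ, ∀ f ∈ W, shift s f ∈ W := by
  induction hφ using Submodule.span_induction with
  | mem x hx =>
    obtain ⟨⟨lam, n⟩, rfl⟩ := hx
    let W : Submodule k (ℤ → k) :=
      Submodule.span k (Set.range fun j : Fin (n + 1) => expMonomial k lam j)
    refine ⟨W, FiniteDimensional.span_of_finite k (Set.finite_range _),
      Submodule.subset_span ⟨⟨n, Nat.lt_succ_self n⟩, rfl⟩, ?_⟩
    intro s f hf
    suffices h : W ≤ W.comap (shift s) from h hf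
    refine Submodule.span_le.2 ?_
    rintro _ ⟨j, rfl⟩
    have : shift s (expMonomial k lam j) =
        ∑ i ∈ Finset.range (j + 1),
          (((lam ^ s : kˣ) : k) * ((s : k) ^ (j - i : ℕ) * ((j : ℕ).choose i : k))) •
            expMonomial k lam i := by
      funext m
      simp only [shift, LinearMap.funLeft_apply, expMonomial, Finset.sum_apply, Pi.smul_apply,
        smul_eq_mul, Int.cast_add, add_pow, zpow_add, Units.val_mul, Finset.sum_mul]
      exact Finset.sum_congr rfl fun i _ => by ring
    change shift s (expMonomial k lam j) ∈ W
    rw [this]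
    refine Submodule.sum_mem _ fun i hi => Submodule.smul_mem _ _ (Submodule.subset_span ?_)
    exact ⟨⟨i, by have := j.2; have := Finset.mem_range.1 hi; omega⟩, rfl⟩
  | zero => exact ⟨⊥, inferInstance, Submodule.zero_mem _, by simp⟩
  | add x y _ _ hx hy =>
    obtain ⟨W, h1, h2, h3⟩ := hx
    obtain ⟨W', h1', h2', h3'⟩ := hy
    refine ⟨W ⊔ W', inferInstance, Submodule.add_mem_sup h2 h2', ?_⟩
    intro s f hf
    obtain ⟨a, ha, b, hb, rfl⟩ := Submodule.mem_sup.1 hf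
    rw [map_add]
    exact Submodule.add_mem_sup (h3 s a ha) (h3' s b hb)
  | smul c x _ hx =>
    obtain ⟨W, h1, h2, h3⟩ := hx
    exact ⟨W, h1, Submodule.smul_mem _ _ h2, h3⟩

/-- An exponential-polynomial function that vanishes on a half-line is zero. -/
theorem eq_zero_of_halfLine {φ : ℤ → k} (hφ : φ ∈ expPoly k) (ε : ℤ) (hε : ε * ε = 1)
    (h : ∀ m : ℤ, 1 ≤ ε * m → φ m = 0) : φ = 0 := by
  obtain ⟨W, hW, hφW, hs⟩ := exists_shift_stable hφ
  let K : Submodule k (ℤ → k) :=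
    { carrier := {f | f ∈ W ∧ ∀ m : ℤ, 1 ≤ ε * m → f m = 0}
      add_mem' := fun {a b} ha hb =>
        ⟨W.add_mem ha.1 hb.1, fun m hm => by simp [ha.2 m hm, hb.2 m hm]⟩
      zero_mem' := ⟨W.zero_mem, fun _ _ => rfl⟩
      smul_mem' := fun c a ha => ⟨W.smul_mem c ha.1, fun m hm => by simp [ha.2 m hm]⟩ }
  have hKW : K ≤ W := fun f hf => hf.1
  have : FiniteDimensional k K := Submodule.finiteDimensional_of_le hKW
  have hK : ∀ f ∈ K, shift ε f ∈ K := fun f hf =>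
    ⟨hs ε f hf.1, fun m hm => hf.2 _ (by rw [mul_add, hε]; omega)⟩
  have hinj : Function.Injective ((shift ε).restrict hK) := by
    intro f g hfg
    have h1 : shift ε (f : ℤ → k) = shift ε (g : ℤ → k) := congrArg Subtype.val hfg
    ext m
    simpa [shift, LinearMap.funLeft_apply] using congrFun h1 (m - ε)
  have hsurj := LinearMap.surjective_of_injective hinj
  have hback : ∀ f ∈ K, shift (-ε) f ∈ K := by
    intro f hf
    obtain ⟨g, hg⟩ := hsurj ⟨f, hf⟩
    have h1 : shift ε (g : ℤ → k) = f := congrArg Subtype.val hg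
    have h2 : shift (-ε) f = g := by
      rw [← h1]; ext m; simp [shift, LinearMap.funLeft_apply]
    rw [h2]; exact g.2
  have hall : ∀ n : ℕ, ∀ f ∈ K, ∀ m : ℤ, 1 ≤ ε * m + n → f m = 0 := by
    intro n
    induction n with
    | zero => exact fun f hf m hm => hf.2 m (by simpa using hm)
    | succ n ih =>
      intro f hf m hm
      have := ih (shift (-ε) f) (hback f hf) (m + ε) (by
        rw [mul_add, hε]; push_cast at hm; omega)
      simpa [shift, LinearMap.funLeft_apply] using this
  funext m
  exact hall (1 - ε * m).toNat φ ⟨hφW, h⟩ m (by omega)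

/-- The degree of a non-zero exponential-polynomial function is positive, and the monoid generated
by the support is the set of its multiples. -/
theorem degree_spec {φ : ℤ → k} (hφ : φ ∈ expPoly k) (h0 : φ ≠ 0) :
    0 < degree φ ∧ AddSubmonoid.closure (Function.support φ) =
      (AddSubgroup.zmultiples (degree φ : ℤ)).toAddSubmonoid := by
  set A := AddSubmonoid.closure (Function.support φ) with hA
  obtain ⟨p, hpA, hp⟩ : ∃ p ∈ A, 0 < p := by
    by_contra! hc
    refine h0 (eq_zero_of_halfLine hφ 1 (by norm_num) fun m hm => ?_)
    by_contra hne
    have := hc m (AddSubmonoid.subset_closure hne)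
    omega
  obtain ⟨q, hqA, hq⟩ : ∃ q ∈ A, q < 0 := by
    by_contra! hc
    refine h0 (eq_zero_of_halfLine hφ (-1) (by norm_num) fun m hm => ?_)
    by_contra hne
    have := hc m (AddSubmonoid.subset_closure hne)
    omega
  have hneg : ∀ m ∈ A, -m ∈ A := by
    intro m hm
    have key : ∀ a b : ℤ, a ∈ A → b ∈ A → 0 < a → b < 0 → -a ∈ A ∧ -b ∈ A := by
      intro a b ha hb h1 h2
      have ea : -a = (a.toNat) • b + (-b - 1).toNat • a := by
        simp only [nsmul_eq_mul]
        rw [Int.toNat_of_nonneg h1.le, Int.toNat_of_nonneg (by omega)]; ring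
      have eb : -b = (a - 1).toNat • b + (-b).toNat • a := by
        simp only [nsmul_eq_mul]
        rw [Int.toNat_of_nonneg (by omega), Int.toNat_of_nonneg (by omega)]; ring
      exact ⟨ea ▸ A.add_mem (A.nsmul_mem hb _) (A.nsmul_mem ha _),
        eb ▸ A.add_mem (A.nsmul_mem hb _) (A.nsmul_mem ha _)⟩
    rcases lt_trichotomy m 0 with h | h | h
    · exact (key p m hpA hm hp h).2
    · simp [h, A.zero_mem]
    · exact (key m q hm hqA h hq).1
  let G : AddSubgroup ℤ := { A with neg_mem' := fun {m} hm => hneg m hm }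
  obtain ⟨g, hg⟩ := Int.subgroup_cyclic G
  have hmem : degree φ ∈ {r : ℕ | A = (AddSubgroup.zmultiples (r : ℤ)).toAddSubmonoid} := by
    refine Nat.sInf_mem ⟨g.natAbs, ?_⟩
    change A = _
    rw [Int.zmultiples_natAbs, AddSubgroup.zmultiples_eq_closure, ← hg]
  have hd : A = (AddSubgroup.zmultiples (degree φ : ℤ)).toAddSubmonoid := hmem
  refine ⟨Nat.pos_of_ne_zero fun hz => ?_, hd⟩
  rw [hd, hz] at hpA
  simp at hpA
  omega

/-- If `ζ` is a primitive `r`-th root of unity, where `r` is the degree of `φ`, then `ζ ^ m = 1` for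
every `m` in the support of `φ`. -/
theorem rootCond {φ : ℤ → k} (hφ : φ ∈ expPoly k) (h0 : φ ≠ 0) {ζ : kˣ}
    (hζ : IsPrimitiveRoot ζ (degree φ)) (m : ℤ) (hm : φ m ≠ 0) : ζ ^ m = 1 := by
  have h1 : m ∈ AddSubmonoid.closure (Function.support φ) := AddSubmonoid.subset_closure hm
  rw [(degree_spec hφ h0).2] at h1
  obtain ⟨c, rfl⟩ := AddSubgroup.mem_zmultiples_iff.1 h1
  rw [smul_eq_mul, mul_comm, zpow_mul, zpow_natCast, hζ.pow_eq_one, one_zpow]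

end ExpPoly

/-! ### Laurent polynomials -/

section Laurent

variable {k : Type*} [Field k]

/-- The `k`-linear map on Laurent polynomials with `t ^ n ↦ F n`. -/
def laurentLift {V : Type*} [AddCommGroup V] [Module k V] (F : ℤ → V) : k[T;T⁻¹] →ₗ[k] V :=
  (AddMonoidAlgebra.basis ℤ k).constr k F

@[simp] theorem laurentLift_T {V : Type*} [AddCommGroup V] [Module k V] (F : ℤ → V) (n : ℤ) :
    laurentLift (k := k) F (LaurentPolynomial.T n) = F n := by
  have h := (AddMonoidAlgebra.basis ℤ k).constr_basis k F n
  rwa [AddMonoidAlgebra.basis_apply] at h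

theorem laurent_induction {P : k[T;T⁻¹] → Prop} (a : k[T;T⁻¹])
    (hT : ∀ n, P (LaurentPolynomial.T n)) (hadd : ∀ a b, P a → P b → P (a + b))
    (hsmul : ∀ (c : k) a, P a → P (c • a)) : P a := by
  induction a using LaurentPolynomial.induction_on' with
  | add p q hp hq => exact hadd p q hp hq
  | C_mul_T n c => rw [← LaurentPolynomial.smul_eq_C_mul]; exact hsmul c _ (hT n)

theorem tensor_induction {M : Type*} [AddCommGroup M] [Module k M] {P : k[T;T⁻¹] ⊗[k] M → Prop}
    (z : k[T;T⁻¹] ⊗[k] M) (h0 : P 0) (hT : ∀ n m, P (LaurentPolynomial.T n ⊗ₜ[k] m))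
    (hadd : ∀ x y, P x → P y → P (x + y)) : P z := by
  induction z using TensorProduct.induction_on with
  | zero => exact h0
  | add x y hx hy => exact hadd x y hx hy
  | tmul a m =>
    induction a using laurent_induction generalizing m with
    | hT n => exact hT n m
    | hadd a b ha hb => rw [TensorProduct.add_tmul]; exact hadd _ _ (ha m) (hb m)
    | hsmul c a ha => rw [TensorProduct.smul_tmul]; exact ha _

/-- The degree derivation `t d/dt` of the Laurent polynomials: `t ^ n ↦ n t ^ n`. -/
def eulerOp : k[T;T⁻¹] →ₗ[k] k[T;T⁻¹] :=
  laurentLift fun n => (n : k) • LaurentPolynomial.T n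

@[simp] theorem eulerOp_T (n : ℤ) : eulerOp (LaurentPolynomial.T n : k[T;T⁻¹]) =
    (n : k) • LaurentPolynomial.T n := laurentLift_T _ _

theorem eulerOp_mul (a b : k[T;T⁻¹]) : eulerOp (a * b) = eulerOp a * b + a * eulerOp b := by
  induction a using laurent_induction with
  | hadd a a' h h' => simp only [add_mul, map_add, h, h']; ring
  | hsmul c a h => simp only [smul_mul_assoc, map_smul, h, smul_add]
  | hT n =>
    induction b using laurent_induction with
    | hadd a a' h h' => simp only [mul_add, map_add, h, h']; ring
    | hsmul c a h => simp only [mul_smul_comm, map_smul, h, smul_add]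
    | hT m =>
      rw [← LaurentPolynomial.T_add, eulerOp_T, eulerOp_T, eulerOp_T, smul_mul_assoc,
        mul_smul_comm, ← LaurentPolynomial.T_add, Int.cast_add, add_smul]

/-- The automorphism `a(t) ↦ a(z t)` of the Laurent polynomials. -/
def scaleHom (z : kˣ) : k[T;T⁻¹] →ₗ[k] k[T;T⁻¹] :=
  laurentLift fun n => ((z ^ n : kˣ) : k) • LaurentPolynomial.T n

@[simp] theorem scaleHom_T (z : kˣ) (n : ℤ) : scaleHom z (LaurentPolynomial.T n : k[T;T⁻¹]) =
    ((z ^ n : kˣ) : k) • LaurentPolynomial.T n := laurentLift_T _ _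

theorem scaleHom_mul (z : kˣ) (a b : k[T;T⁻¹]) :
    scaleHom z (a * b) = scaleHom z a * scaleHom z b := by
  induction a using laurent_induction with
  | hadd a a' h h' => simp only [add_mul, map_add, h, h']
  | hsmul c a h => simp only [smul_mul_assoc, map_smul, h]
  | hT n =>
    induction b using laurent_induction with
    | hadd a a' h h' => simp only [mul_add, map_add, h, h']
    | hsmul c a h => simp only [mul_smul_comm, map_smul, h]
    | hT m =>
      rw [← LaurentPolynomial.T_add, scaleHom_T, scaleHom_T, scaleHom_T, smul_mul_smul_comm,
        ← LaurentPolynomial.T_add, zpow_add, Units.val_mul]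

theorem scaleHom_scaleHom (z w : kˣ) (h : w * z = 1) (a : k[T;T⁻¹]) :
    scaleHom z (scaleHom w a) = a := by
  induction a using laurent_induction with
  | hadd a a' h h' => simp only [map_add, h, h']
  | hsmul c a h => simp only [map_smul, h]
  | hT n =>
    rw [scaleHom_T, map_smul, scaleHom_T, smul_smul, ← Units.val_mul, ← mul_zpow, h, one_zpow,
      Units.val_one, one_smul]

/-- The value `(a · φ)(0)`, where `t` acts on functions on the integers as the shift
`φ ↦ φ (· + 1)`; that is, `∑ₙ aₙ φ(n)` for `a = ∑ₙ aₙ tⁿ`. -/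
def evalAt (φ : ℤ → k) : k[T;T⁻¹] →ₗ[k] k := laurentLift φ

theorem evalAt_scaleHom {φ : ℤ → k} {z : kˣ} (hz : ∀ m, φ m ≠ 0 → z ^ m = 1) (a : k[T;T⁻¹]) :
    evalAt φ (scaleHom z a) = evalAt φ a := by
  induction a using laurent_induction with
  | hadd a a' h h' => simp only [map_add, h, h']
  | hsmul c a h => simp only [map_smul, h]
  | hT n =>
    by_cases h : φ n = 0
    · simp [evalAt, h]
    · simp [evalAt, hz n h]

/-- The linear map `t ^ m ↦ φ(m) t ^ m`. -/
def hadamard (φ : ℤ → k) : k[T;T⁻¹] →ₗ[k] k[T;T⁻¹] :=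
  laurentLift fun m => φ m • LaurentPolynomial.T m

theorem eulerOp_hadamard (φ : ℤ → k) (a : k[T;T⁻¹]) :
    eulerOp (hadamard φ a) = hadamard φ (eulerOp a) := by
  induction a using laurent_induction with
  | hadd a a' h h' => simp only [map_add, h, h']
  | hsmul c a h => simp only [map_smul, h]
  | hT n =>
    rw [eulerOp_T, hadamard, laurentLift_T, map_smul, map_smul, laurentLift_T, eulerOp_T, smul_comm]

end Laurent

attribute [local instance 100] LieRing.ofAssociativeRing

/-! ### The loop algebra of `sl₂` and the centreless affine Lie algebra -/

section Algebras

variable (k : Type*) [Field k]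

/-- The Lie algebra `sl₂` of traceless `2 × 2` matrices. -/
def Sl2 : Type _ := LieAlgebra.SpecialLinear.sl (Fin 2) k

instance : LieRing (Sl2 k) := inferInstanceAs (LieRing (LieAlgebra.SpecialLinear.sl (Fin 2) k))

instance : LieAlgebra k (Sl2 k) :=
  inferInstanceAs (LieAlgebra k (LieAlgebra.SpecialLinear.sl (Fin 2) k))

/-- The underlying matrix of an element of `sl₂`. -/
def Sl2.mat : Sl2 k →ₗ[k] Matrix (Fin 2) (Fin 2) k :=
  (LieAlgebra.SpecialLinear.sl (Fin 2) k).toSubmodule.subtype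

theorem Sl2.mat_lie (x y : Sl2 k) : Sl2.mat k ⁅x, y⁆ = Sl2.mat k x * Sl2.mat k y -
    Sl2.mat k y * Sl2.mat k x := rfl

/-- The loop algebra `sl₂ ⊗ k[t, t⁻¹]` of `sl₂`, with bracket `⁅x ⊗ a, y ⊗ b⁆ = ⁅x, y⁆ ⊗ a b`. -/
def Loop : Type _ := k[T;T⁻¹] ⊗[k] Sl2 k

instance : LieRing (Loop k) := inferInstanceAs (LieRing (k[T;T⁻¹] ⊗[k] Sl2 k))

instance : LieAlgebra k (Loop k) := inferInstanceAs (LieAlgebra k (k[T;T⁻¹] ⊗[k] Sl2 k))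

namespace Loop

variable {k}

/-- The element `x ⊗ a` of the loop algebra. -/
def mk (x : Sl2 k) (a : k[T;T⁻¹]) : Loop k := (a ⊗ₜ[k] x : k[T;T⁻¹] ⊗[k] Sl2 k)

theorem mk_lie (x y : Sl2 k) (a b : k[T;T⁻¹]) : ⁅mk x a, mk y b⁆ = mk ⁅x, y⁆ (a * b) := rfl

theorem mk_add (x : Sl2 k) (a b : k[T;T⁻¹]) : mk x (a + b) = mk x a + mk x b :=
  TensorProduct.add_tmul _ _ _

theorem mk_smul (c : k) (x : Sl2 k) (a : k[T;T⁻¹]) : mk x (c • a) = c • mk x a := rfl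

theorem mk_neg (x : Sl2 k) (a : k[T;T⁻¹]) : mk (-x) a = - mk x a :=
  TensorProduct.tmul_neg _ _

theorem induction {P : Loop k → Prop} (z : Loop k) (h0 : P 0) (hmk : ∀ x a, P (mk x a))
    (hadd : ∀ x y, P x → P y → P (x + y)) : P z :=
  TensorProduct.induction_on (R := k) (M := k[T;T⁻¹]) (N := Sl2 k) (motive := P) z h0
    (fun a x => hmk x a) hadd

theorem induction_T {P : Loop k → Prop} (z : Loop k) (h0 : P 0)
    (hmk : ∀ x n, P (mk x (LaurentPolynomial.T n)))
    (hadd : ∀ x y, P x → P y → P (x + y)) : P z :=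
  tensor_induction (M := Sl2 k) (P := P) z h0 (fun n x => hmk x n) hadd

/-- The linear map `x ⊗ a ↦ x ⊗ F a`. -/
def mapCoeff (F : k[T;T⁻¹] →ₗ[k] k[T;T⁻¹]) : Loop k →ₗ[k] Loop k :=
  F.rTensor (Sl2 k)

theorem mapCoeff_mk (F : k[T;T⁻¹] →ₗ[k] k[T;T⁻¹]) (x : Sl2 k) (a : k[T;T⁻¹]) :
    mapCoeff F (mk x a) = mk x (F a) := rfl

/-- The matrix entries of an element of the loop algebra, which is regarded as a traceless matrix
of Laurent polynomials. -/
def entry (i j : Fin 2) : Loop k →ₗ[k] k[T;T⁻¹] :=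
  (TensorProduct.rid k k[T;T⁻¹]).toLinearMap ∘ₗ
    LinearMap.lTensor k[T;T⁻¹] (Matrix.entryLinearMap k k i j ∘ₗ Sl2.mat k)

theorem entry_mk (i j : Fin 2) (x : Sl2 k) (a : k[T;T⁻¹]) :
    entry i j (mk x a) = Sl2.mat k x i j • a := rfl

theorem entry_lie (i j : Fin 2) (x y : Loop k) :
    entry i j ⁅x, y⁆ = ∑ l, (entry i l x * entry l j y - entry i l y * entry l j x) := by
  induction x using Loop.induction with
  | h0 => simp
  | hadd x x' h h' =>
    simp only [add_lie, map_add, h, h', add_mul, mul_add, ← Finset.sum_add_distrib]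
    exact Finset.sum_congr rfl fun _ _ => by ring
  | hmk x a =>
    induction y using Loop.induction with
    | h0 => simp
    | hadd x x' h h' =>
      simp only [lie_add, map_add, h, h', add_mul, mul_add, ← Finset.sum_add_distrib]
      exact Finset.sum_congr rfl fun _ _ => by ring
    | hmk y b =>
      rw [mk_lie]
      simp only [entry_mk, Sl2.mat_lie, Matrix.sub_apply, Matrix.mul_apply, smul_mul_smul_comm,
        ← Finset.sum_sub_distrib, Finset.sum_smul]
      exact Finset.sum_congr rfl fun l _ => by rw [sub_smul, mul_comm b a]

theorem entry_mapCoeff (i j : Fin 2) (F : k[T;T⁻¹] →ₗ[k] k[T;T⁻¹]) (x : Loop k) :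
    entry i j (mapCoeff F x) = F (entry i j x) := by
  induction x using Loop.induction with
  | h0 => simp
  | hadd x x' h h' => simp only [map_add, h, h']
  | hmk x a => rw [mapCoeff_mk, entry_mk, entry_mk, map_smul]

/-- The automorphism `x ⊗ a(t) ↦ x ⊗ a(z t)` of the loop algebra. -/
def twist (z : kˣ) : Loop k →ₗ⁅k⁆ Loop k where
  toLinearMap := mapCoeff (scaleHom z)
  map_lie' {x y} := by
    induction x using Loop.induction with
    | h0 => simp
    | hadd x x' h h' => simp_all
    | hmk x a =>
      induction y using Loop.induction with
      | h0 => simp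
      | hadd x x' h h' => simp_all
      | hmk y b =>
        simp only [AddHom.toFun_eq_coe, LinearMap.coe_toAddHom, mk_lie, mapCoeff_mk, scaleHom_mul]

theorem twist_mk (z : kˣ) (x : Sl2 k) (a : k[T;T⁻¹]) :
    twist z (mk x a) = mk x (scaleHom z a) := rfl

theorem twist_twist (z w : kˣ) (h : w * z = 1) (x : Loop k) : twist z (twist w x) = x := by
  induction x using Loop.induction with
  | h0 => simp
  | hadd x x' h h' => simp only [map_add, h, h']
  | hmk x a => rw [twist_mk, twist_mk, scaleHom_scaleHom z w h]

theorem entry_twist (i j : Fin 2) (z : kˣ) (x : Loop k) :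
    entry i j (twist z x) = scaleHom z (entry i j x) := entry_mapCoeff i j _ x

variable (k) in
/-- The derivation `x ⊗ t ^ n ↦ n x ⊗ t ^ n` of the loop algebra. -/
def degreeDer : LieDerivation k (Loop k) (Loop k) where
  toLinearMap := mapCoeff eulerOp
  leibniz' x y := by
    induction x using Loop.induction with
    | h0 => simp
    | hadd x x' h h' => simp only [add_lie, lie_add, map_add, h, h']; abel
    | hmk x a =>
      induction y using Loop.induction with
      | h0 => simp
      | hadd x x' h h' => simp only [add_lie, lie_add, map_add, h, h']; abel
      | hmk y b =>
        simp only [mk_lie, mapCoeff_mk, eulerOp_mul, mk_add]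
        rw [← lie_skew x y, mul_comm b, mk_neg, mk_neg]
        abel

theorem degreeDer_mk (x : Sl2 k) (a : k[T;T⁻¹]) : degreeDer k (mk x a) = mk x (eulerOp a) := rfl

theorem entry_degreeDer (i j : Fin 2) (x : Loop k) :
    entry i j (degreeDer k x) = eulerOp (entry i j x) := entry_mapCoeff i j _ x

end Loop

variable {k}

open Loop

variable (k) in
/-- The one-dimensional (abelian) Lie algebra acts on the loop algebra by multiples of the degree
derivation. -/
def degreeAction : k →ₗ⁅k⁆ LieDerivation k (Loop k) (Loop k) where
  toFun c := c • degreeDer k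
  map_add' a b := add_smul a b _
  map_smul' a b := by simp [smul_smul]
  map_lie' {a b} := by
    ext x
    simp [LieRing.of_associative_ring_bracket, mul_comm b a]

variable (k) in
/-- The centreless affine Lie algebra `sl₂ ⊗ k[t, t⁻¹] ⊕ k d`: the pair `⟨x, c⟩` is `x + c d`. -/
def Affine := LieAlgebra.SemiDirectSum (Loop k) k (degreeAction k)

instance : LieRing (Affine k) := inferInstanceAs (LieRing (LieAlgebra.SemiDirectSum _ _ _))

instance : LieAlgebra k (Affine k) :=
  inferInstanceAs (LieAlgebra k (LieAlgebra.SemiDirectSum _ _ (degreeAction k)))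

namespace Affine

/-- The component in the loop algebra. -/
def loop : Affine k →ₗ[k] Loop k := LieAlgebra.SemiDirectSum.projl (degreeAction k)

/-- The coefficient of `d`. -/
def deg : Affine k →ₗ[k] k := (LieAlgebra.SemiDirectSum.projr (degreeAction k)).toLinearMap

theorem loop_lie (x y : Affine k) :
    loop ⁅x, y⁆ = ⁅loop x, loop y⁆ + deg x • degreeDer k (loop y) - deg y • degreeDer k (loop x) :=
  rfl

theorem deg_lie (x y : Affine k) : deg ⁅x, y⁆ = 0 := by
  change x.right * y.right - y.right * x.right = 0
  ring

end Affine

end Algebras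

/-! ### Induced modules and irreducible quotients -/

section Induced

variable {k L : Type*} [Field k] [LieRing L] [LieAlgebra k L]

local notation "U" => UniversalEnvelopingAlgebra k L

section

variable (B : LieSubalgebra k L) (N : Type*) [AddCommGroup N] [Module k N] [LieRingModule B N]

/-- The `U(L)`-submodule of `U(L) ⊗ N` generated by the elements `b ⊗ n - 1 ⊗ b n`, for `b` in the
subalgebra `B`. -/
def indRel : Submodule U (U ⊗[k] N) :=
  Submodule.span U {z | ∃ (b : B) (n : N),
    z = UniversalEnvelopingAlgebra.ι k (b : L) ⊗ₜ[k] n - (1 : U) ⊗ₜ[k] ⁅b, n⁆}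

/-- The induced module `U(L) ⊗_{U(B)} N`. -/
def Ind : Type _ := (U ⊗[k] N) ⧸ indRel B N

instance : AddCommGroup (Ind B N) := inferInstanceAs (AddCommGroup ((U ⊗[k] N) ⧸ indRel B N))

instance : Module U (Ind B N) := inferInstanceAs (Module U ((U ⊗[k] N) ⧸ indRel B N))

instance : Module k (Ind B N) := inferInstanceAs (Module k ((U ⊗[k] N) ⧸ indRel B N))

instance : IsScalarTower k U (Ind B N) :=
  inferInstanceAs (IsScalarTower k U ((U ⊗[k] N) ⧸ indRel B N))

instance : LieRingModule L (Ind B N) where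
  bracket x m := UniversalEnvelopingAlgebra.ι k x • m
  add_lie x y m := by
    change UniversalEnvelopingAlgebra.ι k (x + y) • m = _ • m + _ • m
    rw [map_add, add_smul]
  lie_add x m n := smul_add _ m n
  leibniz_lie x y m := by
    change UniversalEnvelopingAlgebra.ι k x • UniversalEnvelopingAlgebra.ι k y • m =
      UniversalEnvelopingAlgebra.ι k ⁅x, y⁆ • m +
        UniversalEnvelopingAlgebra.ι k y • UniversalEnvelopingAlgebra.ι k x • m
    rw [LieHom.map_lie, LieRing.of_associative_ring_bracket, sub_smul, mul_smul, mul_smul,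
      sub_add_cancel]

theorem Ind.lie_def (x : L) (m : Ind B N) : ⁅x, m⁆ = UniversalEnvelopingAlgebra.ι k x • m := rfl

instance : LieModule k L (Ind B N) where
  smul_lie c x m := by rw [Ind.lie_def, Ind.lie_def, map_smul, smul_assoc]
  lie_smul c x m := by
    rw [Ind.lie_def, Ind.lie_def, ← algebraMap_smul U c m,
      ← algebraMap_smul U c (UniversalEnvelopingAlgebra.ι k x • m), smul_smul, smul_smul,
      Algebra.commutes]

/-- The canonical projection of `U(L) ⊗ N` onto the induced module. -/
def Ind.proj : (U ⊗[k] N) →ₗ[U] Ind B N := (indRel B N).mkQ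

theorem Ind.proj_surjective : Function.Surjective (Ind.proj B N) := (indRel B N).mkQ_surjective

/-- The canonical map `N → U(L) ⊗_{U(B)} N`, `n ↦ 1 ⊗ n`. -/
def Ind.of : N →ₗ[k] Ind B N :=
  ((Ind.proj B N).restrictScalars k) ∘ₗ TensorProduct.mk k U N 1

theorem Ind.of_lie (b : B) (n : N) : Ind.of B N ⁅b, n⁆ = ⁅(b : L), Ind.of B N n⁆ := by
  symm
  refine (Submodule.Quotient.eq (indRel B N)).2 (Submodule.subset_span ⟨b, n, ?_⟩)
  change UniversalEnvelopingAlgebra.ι k (b : L) • ((1 : U) ⊗ₜ[k] n) - _ = _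
  rw [TensorProduct.smul_tmul', smul_eq_mul, mul_one]
  rfl

end

section Twist

/-- The endomorphism of the enveloping algebra induced by an endomorphism of the Lie algebra. -/
def envMap (σ : L →ₗ⁅k⁆ L) : U →ₐ[k] U :=
  UniversalEnvelopingAlgebra.lift k ((UniversalEnvelopingAlgebra.ι k).comp σ)

theorem envMap_ι (σ : L →ₗ⁅k⁆ L) (x : L) :
    envMap σ (UniversalEnvelopingAlgebra.ι k x) = UniversalEnvelopingAlgebra.ι k (σ x) :=
  UniversalEnvelopingAlgebra.lift_ι_apply k _ x

variable {B : LieSubalgebra k L} {N : Type*} [AddCommGroup N] [Module k N] [LieRingModule B N]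

theorem rTensor_envMap_smul (σ : L →ₗ⁅k⁆ L) (u : U) (z : U ⊗[k] N) :
    (envMap σ).toLinearMap.rTensor N (u • z) = envMap σ u • (envMap σ).toLinearMap.rTensor N z := by
  induction z using TensorProduct.induction_on with
  | zero => simp
  | add x y hx hy => rw [smul_add, map_add, hx, hy, map_add, smul_add]
  | tmul v n => simp [TensorProduct.smul_tmul']

/-- If `σ` is an endomorphism of `L` that preserves `B`, and `σ b` acts on `N` as `b` does, then
`u ⊗ n ↦ σ(u) ⊗ n` is a well-defined endomorphism of the vector space `U(L) ⊗_{U(B)} N`. -/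
def indTwist (σ : L →ₗ⁅k⁆ L) (hB : ∀ b : B, σ b ∈ B)
    (hN : ∀ (b : B) (n : N), ⁅(⟨σ b, hB b⟩ : B), n⁆ = ⁅b, n⁆) : Ind B N →ₗ[k] Ind B N :=
  Submodule.mapQ ((indRel B N).restrictScalars k) ((indRel B N).restrictScalars k)
    ((envMap σ).toLinearMap.rTensor N) (by
      intro z hz
      have hz' : z ∈ indRel B N := hz
      change (envMap σ).toLinearMap.rTensor N z ∈ indRel B N
      induction hz' using Submodule.span_induction with
      | mem z h =>
        obtain ⟨b, n, rfl⟩ := h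
        refine Submodule.subset_span ⟨⟨σ b, hB b⟩, n, ?_⟩
        simp only [map_sub, LinearMap.rTensor_tmul, AlgHom.toLinearMap_apply, envMap_ι, map_one, hN]
      | zero => simp
      | add x y _ _ hx hy => rw [map_add]; exact add_mem (hx ‹_›) (hy ‹_›)
      | smul u x _ hx => rw [rTensor_envMap_smul]; exact Submodule.smul_mem _ _ (hx ‹_›))

variable {σ : L →ₗ⁅k⁆ L} {hB : ∀ b : B, σ b ∈ B}
  {hN : ∀ (b : B) (n : N), ⁅(⟨σ b, hB b⟩ : B), n⁆ = ⁅b, n⁆}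

theorem indTwist_mk (z : U ⊗[k] N) :
    indTwist σ hB hN (Ind.proj B N z) =
      Ind.proj B N ((envMap σ).toLinearMap.rTensor N z) := rfl

theorem indTwist_of (n : N) : indTwist σ hB hN (Ind.of B N n) = Ind.of B N n := by
  refine (indTwist_mk _).trans ?_
  rw [TensorProduct.mk_apply, LinearMap.rTensor_tmul, AlgHom.toLinearMap_apply, map_one]
  rfl

theorem indTwist_lie (x : L) (m : Ind B N) :
    indTwist σ hB hN ⁅x, m⁆ = ⁅σ x, indTwist σ hB hN m⁆ := by
  obtain ⟨z, rfl⟩ := Ind.proj_surjective B N m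
  rw [Ind.lie_def, Ind.lie_def, ← map_smul, indTwist_mk, indTwist_mk, rTensor_envMap_smul,
    map_smul, envMap_ι]

end Twist

section IrredQuot

variable (k L) (M : Type*) [AddCommGroup M] [Module k M] [LieRingModule L M]

/-- The sum of all proper submodules of `M`. -/
def properSum : LieSubmodule k L M := sSup {N | N ≠ ⊤}

/-- The quotient of `M` by the sum of all its proper submodules. If this sum is itself a proper
submodule, then it is the unique maximal submodule of `M`, and this is the unique irreducible
quotient of `M`. -/
abbrev IrredQuot := M ⧸ properSum k L M

variable {k L M}

/-- A bijective linear map that is semilinear with respect to an automorphism of `L` permutes the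
proper submodules, and hence preserves their sum. -/
theorem properSum_le_comap {σ τ : L →ₗ⁅k⁆ L} {e e' : M →ₗ[k] M}
    (he : ∀ x m, e ⁅x, m⁆ = ⁅σ x, e m⁆) (he' : ∀ x m, e' ⁅x, m⁆ = ⁅τ x, e' m⁆)
    (hee' : ∀ m, e' (e m) = m) :
    (properSum k L M).toSubmodule ≤ (properSum k L M).toSubmodule.comap e := by
  let C : LieSubmodule k L M :=
    { (properSum k L M).toSubmodule.comap e with
      lie_mem := fun {x m} hm => by
        change e ⁅x, m⁆ ∈ properSum k L M
        rw [he]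
        exact LieSubmodule.lie_mem _ hm }
  suffices h : properSum k L M ≤ C from h
  refine sSup_le fun N hN => ?_
  let N' : LieSubmodule k L M :=
    { N.toSubmodule.comap e' with
      lie_mem := fun {x m} hm => by
        change e' ⁅x, m⁆ ∈ N
        rw [he']
        exact LieSubmodule.lie_mem _ hm }
  have hN' : N' ≠ ⊤ := by
    intro htop
    refine hN (top_le_iff.1 fun m _ => ?_)
    have : e m ∈ N' := htop ▸ LieSubmodule.mem_top _
    have h2 : e' (e m) ∈ N := this
    rwa [hee'] at h2
  intro n hn
  refine (le_sSup (a := N') hN' : N' ≤ properSum k L M) ?_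
  change e' (e n) ∈ N
  rwa [hee']

end IrredQuot

end Induced

/-! ### The modules `L(φ)` over the loop algebra -/

section LoopIrred

open Loop

variable {k : Type*} [Field k]

variable (k) in
/-- The subalgebra `(𝔥 ⊕ 𝔤₊) ⊗ k[t, t⁻¹]` of upper triangular elements of the loop algebra. -/
def borel : LieSubalgebra k (Loop k) :=
  { LinearMap.ker (Loop.entry (k := k) 1 0) with
    lie_mem' := fun {x y} hx hy => by
      have hx : entry 1 0 x = 0 := hx
      have hy : entry 1 0 y = 0 := hy
      change entry 1 0 ⁅x, y⁆ = 0
      simp [entry_lie, hx, hy] }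

theorem mem_borel {x : Loop k} : x ∈ borel k ↔ entry 1 0 x = 0 := Iff.rfl

/-- The one-dimensional module over `(𝔥 ⊕ 𝔤₊) ⊗ k[t, t⁻¹]` on which `h ⊗ a` acts by `(a · φ)(0)`
and `𝔤₊ ⊗ k[t, t⁻¹]` acts by zero. An upper triangular element is of the form `h ⊗ a + e ⊗ b`, where
`a` is its entry in position `(0, 0)`. -/
def Weight (_ : ℤ → k) : Type _ := k

variable (φ : ℤ → k)

instance : AddCommGroup (Weight φ) := inferInstanceAs (AddCommGroup k)

instance : Module k (Weight φ) := inferInstanceAs (Module k k)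

instance : LieRingModule (borel k) (Weight φ) where
  bracket x c := evalAt φ (entry 0 0 (x : Loop k)) • c
  add_lie x y c := by
    change evalAt φ (entry 0 0 ((x : Loop k) + y)) • c = _ • c + _ • c
    rw [map_add, map_add, add_smul]
  lie_add x c d := smul_add _ c d
  leibniz_lie x y c := by
    change evalAt φ (entry 0 0 (x : Loop k)) • evalAt φ (entry 0 0 (y : Loop k)) • c =
      evalAt φ (entry 0 0 ⁅(x : Loop k), (y : Loop k)⁆) • c +
        evalAt φ (entry 0 0 (y : Loop k)) • evalAt φ (entry 0 0 (x : Loop k)) • c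
    have : entry 0 0 ⁅(x : Loop k), (y : Loop k)⁆ = 0 := by
      have hx := mem_borel.1 x.2
      have hy := mem_borel.1 y.2
      simp [entry_lie, hx, hy, mul_comm]
    rw [this, map_zero, zero_smul, zero_add, smul_comm]

theorem Weight.lie_def (x : borel k) (c : Weight φ) :
    ⁅x, c⁆ = evalAt φ (entry 0 0 (x : Loop k)) • c := rfl

instance : LieModule k (borel k) (Weight φ) where
  smul_lie c x m := by
    rw [Weight.lie_def, Weight.lie_def]
    change evalAt φ (entry 0 0 (c • (x : Loop k))) • m = _
    rw [map_smul, map_smul, smul_assoc]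
  lie_smul c x m := by rw [Weight.lie_def, Weight.lie_def, smul_comm]

/-- The generator of the one-dimensional module. -/
def Weight.gen : Weight φ := (1 : k)

/-- The universal highest-weight module `Ind` of highest weight `φ` for the loop algebra. -/
abbrev Verma := Ind (borel k) (Weight φ)

/-- The irreducible highest-weight module `L(φ)` for the loop algebra. -/
abbrev LoopIrred := IrredQuot k (Loop k) (Verma φ)

/-- The highest-weight vector of `L(φ)`. -/
def LoopIrred.hwv : LoopIrred φ :=
  LieSubmodule.Quotient.mk (Ind.of (borel k) (Weight φ) (Weight.gen φ))

variable {φ} {z : kˣ}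

/-- The endomorphism of the universal highest-weight module defined by the automorphism
`x ⊗ a(t) ↦ x ⊗ a(z t)` of the loop algebra. -/
def vermaTwist (hz : ∀ m, φ m ≠ 0 → z ^ m = 1) : Verma φ →ₗ[k] Verma φ :=
  indTwist (Loop.twist z)
    (fun b => by rw [mem_borel, entry_twist, mem_borel.1 b.2, map_zero])
    (fun b n => by rw [Weight.lie_def, Weight.lie_def, entry_twist, evalAt_scaleHom hz])

theorem vermaTwist_lie (hz : ∀ m, φ m ≠ 0 → z ^ m = 1) (x : Loop k) (m : Verma φ) :
    vermaTwist hz ⁅x, m⁆ = ⁅Loop.twist z x, vermaTwist hz m⁆ := indTwist_lie x m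

theorem vermaTwist_vermaTwist (z w : kˣ) (hz : ∀ m, φ m ≠ 0 → z ^ m = 1)
    (hw : ∀ m, φ m ≠ 0 → w ^ m = 1) (h : w * z = 1) (m : Verma φ) :
    vermaTwist hz (vermaTwist hw m) = m := by
  obtain ⟨u, rfl⟩ := Ind.proj_surjective _ _ m
  refine (congrArg (vermaTwist hz) (indTwist_mk u)).trans ((indTwist_mk _).trans ?_)
  congr 1
  rw [← LinearMap.comp_apply, ← LinearMap.rTensor_comp]
  have : (envMap (Loop.twist z)).comp (envMap (Loop.twist w)) = AlgHom.id k _ := by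
    refine UniversalEnvelopingAlgebra.hom_ext k (LieHom.ext fun x => ?_)
    change envMap (Loop.twist z) (envMap (Loop.twist w) (UniversalEnvelopingAlgebra.ι k x)) =
      UniversalEnvelopingAlgebra.ι k x
    rw [envMap_ι, envMap_ι, Loop.twist_twist z w h]
  have h2 : (envMap (Loop.twist z)).toLinearMap ∘ₗ (envMap (Loop.twist w)).toLinearMap =
      LinearMap.id := congrArg AlgHom.toLinearMap this
  rw [h2, LinearMap.rTensor_id, LinearMap.id_apply]

variable (φ) in
/-- The map `η` on `L(φ)`, for a scalar `ζ` such that `ζ ^ m = 1` on the support of `φ`. It is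
characterised by `eta_hwv` and `eta_lie`. -/
def eta (ζ : kˣ) (hζ : ∀ m, φ m ≠ 0 → ζ ^ m = 1) : Module.End k (LoopIrred φ) :=
  have hinv : ∀ m, φ m ≠ 0 → (ζ⁻¹) ^ m = 1 := fun m hm => by rw [inv_zpow, hζ m hm, inv_one]
  Submodule.mapQ _ _ (vermaTwist hinv)
    (properSum_le_comap (vermaTwist_lie hinv) (vermaTwist_lie hζ)
      (vermaTwist_vermaTwist ζ ζ⁻¹ hζ hinv (inv_mul_cancel ζ)))

theorem eta_hwv (ζ : kˣ) (hζ : ∀ m, φ m ≠ 0 → ζ ^ m = 1) :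
    eta φ ζ hζ (LoopIrred.hwv φ) = LoopIrred.hwv φ :=
  congrArg (Submodule.Quotient.mk (p := (properSum k (Loop k) (Verma φ)).toSubmodule))
    (indTwist_of _)

theorem eta_lie (ζ : kˣ) (hζ : ∀ m, φ m ≠ 0 → ζ ^ m = 1) (x : Sl2 k) (a : k[T;T⁻¹])
    (w : LoopIrred φ) :
    eta φ ζ hζ ⁅Loop.mk x a, w⁆ = ⁅Loop.mk x (scaleHom ζ⁻¹ a), eta φ ζ hζ w⁆ := by
  obtain ⟨m, rfl⟩ := Submodule.mkQ_surjective _ w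
  exact congrArg (Submodule.Quotient.mk (p := (properSum k (Loop k) (Verma φ)).toSubmodule))
    (vermaTwist_lie _ (Loop.mk x a) m)

end LoopIrred

/-! ### The modules `L̃(φ)` over the centreless affine Lie algebra -/

section AffineIrred

open Loop

variable {k : Type*} [Field k]

variable (k) in
/-- The subalgebra `(𝔥 ⊕ 𝔤₊) ⊗ k[t, t⁻¹] ⊕ k d` of the centreless affine Lie algebra. -/
def affineBorel : LieSubalgebra k (Affine k) :=
  { LinearMap.ker (Loop.entry (k := k) 1 0 ∘ₗ Affine.loop) with
    lie_mem' := fun {x y} hx hy => by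
      have hx : entry 1 0 (Affine.loop x) = 0 := hx
      have hy : entry 1 0 (Affine.loop y) = 0 := hy
      change entry 1 0 (Affine.loop ⁅x, y⁆) = 0
      simp [Affine.loop_lie, entry_lie, entry_degreeDer, hx, hy] }

theorem mem_affineBorel {x : Affine k} : x ∈ affineBorel k ↔ entry 1 0 (Affine.loop x) = 0 :=
  Iff.rfl

/-- The space of Laurent polynomials, as a module over `(𝔥 ⊕ 𝔤₊) ⊗ k[t, t⁻¹] ⊕ k d`, where
`h ⊗ t ^ m` acts by `t ^ n ↦ φ(m) t ^ (m + n)`, where `d` acts by `t ^ n ↦ n t ^ n`, and where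
`𝔤₊ ⊗ k[t, t⁻¹]` acts by zero. -/
def LaurentModule (_ : ℤ → k) : Type _ := k[T;T⁻¹]

variable (φ : ℤ → k)

instance : AddCommGroup (LaurentModule φ) := inferInstanceAs (AddCommGroup k[T;T⁻¹])

instance : Module k (LaurentModule φ) := inferInstanceAs (Module k k[T;T⁻¹])

/-- The action of `x` on the Laurent polynomials: `p ↦ φ(a) p + c (t d/dt) p`, where `x` is
`h ⊗ a + c d` up to strictly upper triangular elements, and where `φ(t ^ m) = φ(m) t ^ m`. -/
def laurentAct (x : Affine k) : k[T;T⁻¹] →ₗ[k] k[T;T⁻¹] :=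
  LinearMap.mulLeft k (hadamard φ (entry 0 0 (Affine.loop x))) + Affine.deg x • eulerOp

theorem laurentAct_apply (x : Affine k) (p : k[T;T⁻¹]) : laurentAct φ x p =
    hadamard φ (entry 0 0 (Affine.loop x)) * p + Affine.deg x • eulerOp p := rfl

theorem laurentAct_add (x y : Affine k) (p : k[T;T⁻¹]) :
    laurentAct φ (x + y) p = laurentAct φ x p + laurentAct φ y p := by
  simp only [laurentAct_apply, map_add, add_mul, add_smul]
  abel

theorem laurentAct_smul (c : k) (x : Affine k) (p : k[T;T⁻¹]) :
    laurentAct φ (c • x) p = c • laurentAct φ x p := by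
  simp only [laurentAct_apply, map_smul, smul_mul_assoc, smul_add, smul_assoc]

theorem laurentAct_lie {x y : Affine k} (hx : x ∈ affineBorel k) (hy : y ∈ affineBorel k)
    (p : k[T;T⁻¹]) : laurentAct φ x (laurentAct φ y p) =
      laurentAct φ ⁅x, y⁆ p + laurentAct φ y (laurentAct φ x p) := by
  have hx := mem_affineBorel.1 hx
  have hy := mem_affineBorel.1 hy
  have h : entry 0 0 (Affine.loop ⁅x, y⁆) =
      Affine.deg x • eulerOp (entry 0 0 (Affine.loop y)) -
        Affine.deg y • eulerOp (entry 0 0 (Affine.loop x)) := by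
    simp [Affine.loop_lie, entry_lie, entry_degreeDer, hx, hy, mul_comm]
  simp only [laurentAct_apply, h, Affine.deg_lie, map_add, map_sub, map_smul, eulerOp_mul,
    eulerOp_hadamard, zero_smul, add_zero, sub_mul, smul_mul_assoc, smul_add, mul_left_comm (hadamard φ (entry 0 0 (Affine.loop x)))
      (hadamard φ (entry 0 0 (Affine.loop y)))]
  rw [smul_comm (Affine.deg x) (Affine.deg y)]
  abel

instance : LieRingModule (affineBorel k) (LaurentModule φ) where
  bracket x p := laurentAct φ x p
  add_lie x y p := laurentAct_add φ x y p
  lie_add x p q := map_add (laurentAct φ x) p q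
  leibniz_lie x y p := laurentAct_lie φ x.2 y.2 p

theorem LaurentModule.lie_def (x : affineBorel k) (p : LaurentModule φ) :
    ⁅x, p⁆ = laurentAct φ x p := rfl

instance : LieModule k (affineBorel k) (LaurentModule φ) where
  smul_lie c x p := laurentAct_smul φ c x p
  lie_smul c x p := map_smul (laurentAct φ x) c p

/-- The submodule `H(φ)` of the Laurent polynomials that is generated by `1`. -/
def hMod : LieSubmodule k (affineBorel k) (LaurentModule φ) :=
  LieSubmodule.lieSpan k (affineBorel k) {(1 : k[T;T⁻¹])}

/-- The irreducible module `L̃(φ)`: the irreducible quotient of the module induced by `H(φ)`. -/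
abbrev AffineIrred := IrredQuot k (Affine k) (Ind (affineBorel k) (hMod φ))

/-- The one-dimensional module on which the loop algebra acts by zero and `d` acts by `γ`. -/
def OneDim (_ : k) : Type _ := k

variable (γ : k)

instance : AddCommGroup (OneDim γ) := inferInstanceAs (AddCommGroup k)

instance : Module k (OneDim γ) := inferInstanceAs (Module k k)

instance : LieRingModule (Affine k) (OneDim γ) where
  bracket x c := (Affine.deg x * γ) • c
  add_lie x y c := by
    rw [map_add, add_mul, add_smul]
  lie_add x c d := smul_add _ c d
  leibniz_lie x y c := by
    change (Affine.deg x * γ) • (Affine.deg y * γ) • c =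
      (Affine.deg ⁅x, y⁆ * γ) • c + (Affine.deg y * γ) • (Affine.deg x * γ) • c
    rw [Affine.deg_lie, zero_mul, zero_smul, zero_add, smul_comm]

theorem OneDim.lie_def (x : Affine k) (c : OneDim γ) : ⁅x, c⁆ = (Affine.deg x * γ) • c := rfl

instance : LieModule k (Affine k) (OneDim γ) where
  smul_lie c x m := by
    rw [OneDim.lie_def, OneDim.lie_def, map_smul, smul_eq_mul, mul_assoc, mul_smul]
  lie_smul c x m := by rw [OneDim.lie_def, OneDim.lie_def, smul_comm]

end AffineIrred

/-! ### Loop modules -/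

section LoopModule

variable {k : Type*} [Field k]

variable (k) in
/-- The loop module `M ⊗ k[t, t⁻¹]` of a module `M` over the loop algebra. -/
def LoopModule (M : Type*) [AddCommGroup M] [Module k M] : Type _ := k[T;T⁻¹] ⊗[k] M

namespace LoopModule

variable {M : Type*} [AddCommGroup M] [Module k M]

instance : AddCommGroup (LoopModule k M) := inferInstanceAs (AddCommGroup (k[T;T⁻¹] ⊗[k] M))

instance : Module k (LoopModule k M) := inferInstanceAs (Module k (k[T;T⁻¹] ⊗[k] M))

/-- The element `u ⊗ a` of the loop module, as a linear function of `u`. -/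
def mk (a : k[T;T⁻¹]) : M →ₗ[k] LoopModule k M := TensorProduct.mk k k[T;T⁻¹] M a

/-- The linear map `u ⊗ a ↦ f(u) ⊗ F(a)`. -/
def map (f : M →ₗ[k] M) (F : k[T;T⁻¹] →ₗ[k] k[T;T⁻¹]) : Module.End k (LoopModule k M) :=
  TensorProduct.map F f

theorem map_mk (f : M →ₗ[k] M) (F : k[T;T⁻¹] →ₗ[k] k[T;T⁻¹]) (u : M) (a : k[T;T⁻¹]) :
    map f F (mk a u) = mk (F a) (f u) := rfl

theorem induction {P : LoopModule k M → Prop} (w : LoopModule k M) (h0 : P 0)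
    (hmk : ∀ n u, P (mk (LaurentPolynomial.T n) u)) (hadd : ∀ x y, P x → P y → P (x + y)) : P w :=
  tensor_induction (M := M) (P := P) w h0 hmk hadd

theorem mk_smul (c : k) (a : k[T;T⁻¹]) (u : M) : mk (c • a) u = c • mk a u := rfl

theorem mk_add (a b : k[T;T⁻¹]) (u : M) : mk (a + b) u = mk a u + mk b u :=
  TensorProduct.add_tmul _ _ _

/-- The degree operator on the loop module: `u ⊗ t ^ n ↦ n u ⊗ t ^ n`. -/
def degAct : Module.End k (LoopModule k M) := map LinearMap.id eulerOp

theorem degAct_mk (u : M) (a : k[T;T⁻¹]) : degAct (mk a u) = mk (eulerOp a) u := rfl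

variable [LieRingModule (Loop k) M] [LieModule k (Loop k) M]

/-- The action of the elements `x ⊗ t ^ m` on the loop module: `x ⊗ t ^ m` maps `u ⊗ a` to
`(x ⊗ t ^ m) u ⊗ t ^ m a`. -/
def monomialAct (m : ℤ) : Sl2 k →ₗ[k] Module.End k (LoopModule k M) where
  toFun x := map (LieModule.toEnd k (Loop k) M (Loop.mk x (LaurentPolynomial.T m)))
    (LinearMap.mulLeft k (LaurentPolynomial.T m))
  map_add' x y := by
    have : Loop.mk (x + y) (LaurentPolynomial.T m) =
      Loop.mk x (LaurentPolynomial.T m) + Loop.mk y (LaurentPolynomial.T m) :=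
        TensorProduct.tmul_add _ _ _
    rw [this, map_add]
    exact TensorProduct.map_add_right _ _ _
  map_smul' c x := by
    have : Loop.mk (c • x) (LaurentPolynomial.T m) = c • Loop.mk x (LaurentPolynomial.T m) :=
        TensorProduct.tmul_smul _ _ _
    rw [this, map_smul]
    exact TensorProduct.map_smul_right _ _ _

/-- The action of the loop algebra on the loop module. -/
def loopAct : Loop k →ₗ[k] Module.End k (LoopModule k M) :=
  TensorProduct.lift (laurentLift monomialAct)

theorem loopAct_mk (x : Sl2 k) (m : ℤ) (u : M) (a : k[T;T⁻¹]) :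
    loopAct (Loop.mk x (LaurentPolynomial.T m)) (mk a u) =
      mk (LaurentPolynomial.T m * a) ⁅Loop.mk x (LaurentPolynomial.T m), u⁆ := by
  have h : (loopAct (Loop.mk x (LaurentPolynomial.T m)) : Module.End k (LoopModule k M)) =
      laurentLift monomialAct (LaurentPolynomial.T m) x := TensorProduct.lift.tmul _ _
  rw [h, laurentLift_T]
  rfl

theorem loopAct_lie (x y : Loop k) (w : LoopModule k M) :
    loopAct x (loopAct y w) = loopAct ⁅x, y⁆ w + loopAct y (loopAct x w) := by
  induction w using LoopModule.induction with
  | h0 => simp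
  | hadd v w hv hw => simp only [map_add, hv, hw]; abel
  | hmk n u =>
    induction x using Loop.induction_T with
    | h0 => simp
    | hadd x x' h h' => simp only [map_add, add_lie, LinearMap.add_apply, h, h']; abel
    | hmk x m =>
      induction y using Loop.induction_T with
      | h0 => simp
      | hadd x x' h h' => simp only [map_add, lie_add, LinearMap.add_apply, h, h']; abel
      | hmk y l =>
        rw [Loop.mk_lie, ← LaurentPolynomial.T_add]
        simp only [loopAct_mk]
        rw [mul_left_comm (LaurentPolynomial.T l), ← mul_assoc, ← LaurentPolynomial.T_add,
          ← map_add, LaurentPolynomial.T_add, ← Loop.mk_lie, ← leibniz_lie]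

theorem degAct_loopAct (x : Loop k) (w : LoopModule k M) :
    degAct (loopAct x w) = loopAct (Loop.degreeDer k x) w + loopAct x (degAct w) := by
  induction w using LoopModule.induction with
  | h0 => simp
  | hadd v w hv hw => simp only [map_add, hv, hw]; abel
  | hmk n u =>
    induction x using Loop.induction_T with
    | h0 => simp
    | hadd x x' h h' => simp only [map_add, LinearMap.add_apply, h, h']; abel
    | hmk x m =>
      rw [Loop.degreeDer_mk, eulerOp_T, Loop.mk_smul, map_smul, LinearMap.smul_apply]
      simp only [loopAct_mk, degAct_mk, ← LaurentPolynomial.T_add, eulerOp_T, mk_smul, map_smul,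
        Int.cast_add, add_smul, mk_add]

instance : LieRingModule (Affine k) (LoopModule k M) where
  bracket x w := loopAct (Affine.loop x) w + Affine.deg x • degAct w
  add_lie x y w := by
    simp only [map_add, LinearMap.add_apply, add_smul]
    abel
  lie_add x v w := by
    simp only [map_add, smul_add]
    abel
  leibniz_lie x y w := by
    simp only [Affine.loop_lie, Affine.deg_lie, map_add, map_sub, map_smul, LinearMap.add_apply,
      LinearMap.sub_apply, LinearMap.smul_apply, degAct_loopAct, zero_smul, smul_add, add_zero]
    rw [loopAct_lie (Affine.loop x) (Affine.loop y),
      smul_comm (Affine.deg x) (Affine.deg y) (degAct (degAct w))]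
    abel

theorem lie_def (x : Affine k) (w : LoopModule k M) :
    ⁅x, w⁆ = loopAct (Affine.loop x) w + Affine.deg x • degAct w := rfl

instance : LieModule k (Affine k) (LoopModule k M) where
  smul_lie c x w := by
    simp only [lie_def, map_smul, LinearMap.smul_apply, smul_add, smul_assoc]
  lie_smul c x w := by
    simp only [lie_def, map_smul, smul_add, smul_comm c]

end LoopModule

variable (φ : ℤ → k)

/-- The map `u ⊗ a(t) ↦ η(u) ⊗ a(ζ t)` on the loop module of `L(φ)`. -/
def etaHat (ζ : kˣ) (hζ : ∀ m, φ m ≠ 0 → ζ ^ m = 1) : Module.End k (LoopModule k (LoopIrred φ)) :=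
  LoopModule.map (eta φ ζ hζ) (scaleHom ζ)

theorem etaHat_mk (ζ : kˣ) (hζ : ∀ m, φ m ≠ 0 → ζ ^ m = 1) (u : LoopIrred φ) (a : k[T;T⁻¹]) :
    etaHat φ ζ hζ (LoopModule.mk a u) = LoopModule.mk (scaleHom ζ a) (eta φ ζ hζ u) := rfl

end LoopModule

end

end LoopSl2

/-! Write `v` for the highest-weight vector of L(φ). On u ⊗ t^n the action of x ⊗ t^m multiplies the
power of t by t^m, so the factor ζ^(-m) that η puts on x ⊗ t^m cancels the factor ζ^m that comes
from t ↦ ζt. Hence η̂ commutes with the affine algebra, and its eigenspaces are submodules.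

The structure of the loop module is read off from the vectors v ⊗ t^n. Since h ⊗ t^m sends v ⊗ t^n
to φ(m) v ⊗ t^(m+n), and the support of φ generates rℤ as a monoid, a submodule that contains v ⊗
t^n contains v ⊗ t^(n+s) for every s in rℤ (`hwvT_add_mem`). On the other hand v ⊗ t^n has
η̂-eigenvalue ζ^n, which depends only on n mod r. All the v ⊗ t^n together generate the loop module,
so it is the sum of r submodules, each generated by one v ⊗ t^j and contained in one eigenspace.
This gives the decomposition and shows that v ⊗ t^i generates the eigenspace for ζ^i
(`etaEigen_le_of_hwvT_mem`).

Irreducibility of an eigenspace follows once every non-zero submodule P is known to contain some v ⊗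
t^n (`exists_hwvT_mem`). Because d acts with distinct eigenvalues, P is graded. The sum of its
homogeneous slices is a non-zero submodule of the irreducible module L(φ), hence all of it. If no
slice contained v, all slices would lie in the sum of the lower weight spaces of h ⊗ 1
(`exists_weight_complement`), which misses v.

For the comparison with L̃(φ), the map p ↦ v ⊗ p from H(φ) extends to the induced module and lands
in the fixed vectors of η̂, because H(φ) consists of Laurent polynomials invariant under t ↦ ζt. As
H(φ) is irreducible, the sum of the proper submodules of the induced module is proper, and its
quotient is isomorphic to the irreducible space of fixed vectors. Multiplication by t^(-i) carries
the eigenspace for ζ^i to the fixed vectors and shifts d by i, which accounts for the factor k_i.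

That L(φ) is non-zero is seen in a model of its universal cover by differential operators on a
polynomial ring, in which v corresponds to 1. -/

open scoped TensorProduct LaurentPolynomial

namespace LoopSl2

noncomputable section

attribute [local instance 100] LieRing.ofAssociativeRing

/-! ### Eigenvector components of elements of a stable subspace -/

section Eigen

variable {k V : Type*} [Field k] [AddCommGroup V] [Module k V]

/-- A stable subspace that contains a sum of eigenvectors with distinct eigenvalues contains
each of the summands. -/
theorem mem_of_sum_eigenvectors_mem (f : Module.End k V) (S : Submodule k V)
    (hS : ∀ x ∈ S, f x ∈ S) {ι : Type*} (s : Finset ι) (μ : ι → k) (hμ : Set.InjOn μ s)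
    (x : ι → V) (hx : ∀ i ∈ s, f (x i) = μ i • x i) (h : ∑ i ∈ s, x i ∈ S) :
    ∀ i ∈ s, x i ∈ S := by
  classical
  induction s using Finset.induction_on generalizing x with
  | empty => simp
  | insert a s ha ih =>
    have hs : ∀ i ∈ s, x i ∈ S := by
      -- Applying f - μ a removes the summand x a and multiplies the others by the non-zero scalars
      -- μ i - μ a.
      have key := ih (hμ.mono (by simp)) (fun i => (μ i - μ a) • x i)
        (fun i hi => by rw [map_smul, hx i (Finset.mem_insert_of_mem hi), smul_comm]) (by
          have h2 := S.sub_mem (hS _ h) (S.smul_mem (μ a) h)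
          rw [map_sum, Finset.smul_sum, ← Finset.sum_sub_distrib, Finset.sum_insert ha,
            hx a (Finset.mem_insert_self a s), sub_self, zero_add] at h2
          convert h2 using 1
          exact Finset.sum_congr rfl fun i hi => by
            rw [hx i (Finset.mem_insert_of_mem hi), sub_smul])
      intro i hi
      have hne : μ i - μ a ≠ 0 := by
        rw [sub_ne_zero]
        intro e
        have := hμ (by simp [hi]) (by simp) e
        exact ha (this ▸ hi)
      exact (S.smul_mem_iff hne).1 (key i hi)
    intro i hi
    rcases Finset.mem_insert.1 hi with rfl | hi
    · rw [Finset.sum_insert ha] at h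
      exact (S.add_mem_iff_left (S.sum_mem hs)).1 h
    · exact hs i hi

end Eigen

/-! ### Weight spaces of a module generated by highest-weight vectors -/

section Triangular

variable {k L M : Type*} [Field k] [CharZero k] [LieRing L] [LieAlgebra k L] [AddCommGroup M]
  [Module k M] [LieRingModule L M] [LieModule k L M]

/-- A module that is generated by a space `T` of highest weight vectors splits, for the action
of `h₀`, as the sum of `T` and a complement `C` that contains all stable subspaces that do not
meet `T`. -/
theorem exists_weight_complement (Lm L0 Lp : Submodule k L) (hL : Lm ⊔ L0 ⊔ Lp = ⊤)
    (h0m : ∀ x ∈ L0, ∀ y ∈ Lm, ⁅x, y⁆ ∈ Lm) (hpm : ∀ x ∈ Lp, ∀ y ∈ Lm, ⁅x, y⁆ ∈ L0)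
    (h₀ : L) (hh : ∀ y ∈ Lm, ⁅h₀, y⁆ = (-2 : k) • y) (T : Submodule k M)
    (hT0 : ∀ x ∈ L0, ∀ t ∈ T, ⁅x, t⁆ ∈ T) (hTp : ∀ x ∈ Lp, ∀ t ∈ T, ⁅x, t⁆ = 0) (c : k)
    (hc : ∀ t ∈ T, ⁅h₀, t⁆ = c • t)
    (hspan : ∀ P : LieSubmodule k L M, T ≤ P.toSubmodule → P = ⊤) :
    ∃ C : Submodule k M, Disjoint T C ∧
      ∀ S : Submodule k M, (∀ s ∈ S, ⁅h₀, s⁆ ∈ S) → Disjoint S T → S ≤ C := by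
  -- `W n` is spanned by the n-fold products of elements of `Lm` applied to T. It will turn out to
  -- be the part of weight c - 2n.
  let W : ℕ → Submodule k M := fun n =>
    Nat.rec T (fun _ X => Submodule.span k {m | ∃ y ∈ Lm, ∃ t ∈ X, ⁅y, t⁆ = m}) n
  have hW : ∀ n y t, y ∈ Lm → t ∈ W n → ⁅y, t⁆ ∈ W (n + 1) := fun n y t hy ht =>
    Submodule.subset_span ⟨y, hy, t, ht, rfl⟩
  have hind : ∀ (n : ℕ) (x : L) (S : Submodule k M), (∀ y ∈ Lm, ∀ t ∈ W n, ⁅x, ⁅y, t⁆⁆ ∈ S) →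
      ∀ w ∈ W (n + 1), ⁅x, w⁆ ∈ S := by
    intro n x S h w hw
    have : W (n + 1) ≤ S.comap (LieModule.toEnd k L M x) := by
      refine Submodule.span_le.2 ?_
      rintro _ ⟨y, hy, t, ht, rfl⟩
      exact h y hy t ht
    exact this hw
  have h0 : ∀ n, ∀ x ∈ L0, ∀ t ∈ W n, ⁅x, t⁆ ∈ W n := by
    intro n
    induction n with
    | zero => exact hT0
    | succ n ih =>
      intro x hx
      refine hind n x _ fun y hy t ht => ?_
      rw [leibniz_lie]
      exact add_mem (hW _ _ _ (h0m x hx y hy) ht) (hW _ _ _ hy (ih x hx t ht))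
  -- `W'` is `W` shifted by one, with zero below T, so that the action of `Lp` lowers the index
  -- without a case distinction.
  let W' : ℕ → Submodule k M := fun n => Nat.casesOn n ⊥ W
  have hW' : ∀ n y t, y ∈ Lm → t ∈ W' n → ⁅y, t⁆ ∈ W n := by
    intro n y t hy ht
    cases n with
    | zero =>
      rw [(Submodule.mem_bot k).1 ht, lie_zero]; exact zero_mem _
    | succ n => exact hW n y t hy ht
  have hp : ∀ n, ∀ x ∈ Lp, ∀ t ∈ W n, ⁅x, t⁆ ∈ W' n := by
    intro n
    induction n with
    | zero => exact fun x hx t ht => (Submodule.mem_bot k).2 (hTp x hx t ht)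
    | succ n ih =>
      intro x hx
      refine hind n x _ fun y hy t ht => ?_
      rw [leibniz_lie]
      exact add_mem (h0 n _ (hpm x hx y hy) t ht) (hW' _ _ _ hy (ih x hx t ht))
  have hW'le : ∀ n, W' n ≤ ⨆ n, W n := by
    rintro (_ | n)
    · exact bot_le
    · exact le_iSup W n
  have heig : ∀ n, ∀ t ∈ W n, ⁅h₀, t⁆ = (c - 2 * n) • t := by
    intro n
    induction n with
    | zero =>
      intro t ht
      rw [hc t ht, Nat.cast_zero, mul_zero, sub_zero]
    | succ n ih =>
      intro t ht
      have : W (n + 1) ≤ (LieModule.toEnd k L M h₀ - (c - 2 * (n + 1 : ℕ)) • 1).ker := by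
        refine Submodule.span_le.2 ?_
        rintro _ ⟨y, hy, t, ht, rfl⟩
        have : ⁅h₀, ⁅y, t⁆⁆ = (c - 2 * (n + 1 : ℕ)) • ⁅y, t⁆ := by
          rw [leibniz_lie, hh y hy, ih t ht, smul_lie, lie_smul, ← add_smul]
          congr 1
          push_cast
          ring
        simp [this]
      have := this ht
      simpa [sub_eq_zero] using this
  let P : LieSubmodule k L M :=
    { (⨆ n, W n : Submodule k M) with
      lie_mem := by
        intro x m hm
        change m ∈ ⨆ n, W n at hm
        change ⁅x, m⁆ ∈ ⨆ n, W n
        induction hm using Submodule.iSup_induction' with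
        | zero => rw [lie_zero]; exact zero_mem _
        | add a b _ _ ha hb => rw [lie_add]; exact add_mem ha hb
        | mem n t ht =>
          have hx : x ∈ Lm ⊔ L0 ⊔ Lp := hL ▸ Submodule.mem_top
          obtain ⟨x', hx', xp, hxp, rfl⟩ := Submodule.mem_sup.1 hx
          obtain ⟨xm, hxm, x0, hx0, rfl⟩ := Submodule.mem_sup.1 hx'
          rw [add_lie, add_lie]
          exact add_mem (add_mem (le_iSup W (n + 1) (hW n _ _ hxm ht))
            (le_iSup W n (h0 n _ hx0 t ht))) (hW'le n (hp n _ hxp t ht)) }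
  have hPtop : ∀ m, m ∈ ⨆ n, W n := by
    intro m
    have hP := hspan P (le_iSup W 0)
    have : m ∈ P := hP ▸ LieSubmodule.mem_top m
    exact this
  -- The complement collects the weights c - 2n with n ≥ 1, all different from c in characteristic
  -- zero. A vector of T in this sum has all its components in T, where the weight is c, so they
  -- vanish.
  refine ⟨⨆ n, W (n + 1), ?_, ?_⟩
  · rw [Submodule.disjoint_def]
    intro x hxT hx
    obtain ⟨f, hf, rfl⟩ := (Submodule.mem_iSup_iff_exists_finsupp _ _).1 hx
    refine Finset.sum_eq_zero fun i hi => ?_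
    have h1 := mem_of_sum_eigenvectors_mem (LieModule.toEnd k L M h₀) T
      (fun t ht => by simpa [hc t ht] using T.smul_mem c ht) f.support
      (fun i => c - 2 * ((i + 1 : ℕ) : k)) (by
        intro i _ j _ hij
        have : (2 : k) ≠ 0 := two_ne_zero
        simpa [this] using hij) f (fun i _ => heig (i + 1) _ (hf i)) hxT i hi
    have h2 := hc _ h1
    rw [heig (i + 1) _ (hf i), ← sub_eq_zero, ← sub_smul, smul_eq_zero] at h2
    refine h2.resolve_left ?_
    have : (2 : k) * ((i + 1 : ℕ) : k) ≠ 0 := mul_ne_zero two_ne_zero (Nat.cast_ne_zero.2 (by omega))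
    simpa using this
  · intro S hS hdisj s hs
    obtain ⟨f, hf, rfl⟩ := (Submodule.mem_iSup_iff_exists_finsupp _ _).1 (hPtop s)
    refine Submodule.sum_mem _ fun i hi => ?_
    -- A stable S contains the weight components of its elements. The one of index 0 lies in both S
    -- and T, so it is zero and only lower weights remain.
    have h1 := mem_of_sum_eigenvectors_mem (LieModule.toEnd k L M h₀) S hS f.support
      (fun i => c - 2 * (i : k)) (by
        intro i _ j _ hij
        have : (2 : k) ≠ 0 := two_ne_zero
        simpa [this] using hij) f (fun i _ => heig i _ (hf i)) hs i hi
    cases i with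
    | zero =>
      rw [Submodule.disjoint_def.1 hdisj _ h1 (hf 0)]
      exact zero_mem _
    | succ i => exact le_iSup (fun n => W (n + 1)) i (hf (i + 1))

end Triangular

/-! ### Irreducible quotients -/

section Irreducible

variable {k L M : Type*} [Field k] [LieRing L] [AddCommGroup M] [Module k M] [LieRingModule L M]

/-- If every non-zero vector of `T` generates the module, then the sum of the proper submodules
is proper, provided that `T` has a complement as in `exists_weight_complement`. -/
theorem properSum_ne_top {h₀ : L} {T : Submodule k M} (hT : T ≠ ⊥)
    (hC : ∃ C : Submodule k M, Disjoint T C ∧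
      ∀ S : Submodule k M, (∀ s ∈ S, ⁅h₀, s⁆ ∈ S) → Disjoint S T → S ≤ C)
    (hgen : ∀ P : LieSubmodule k L M, ∀ t ∈ T, t ∈ P → t ≠ 0 → P = ⊤) :
    properSum k L M ≠ ⊤ := by
  obtain ⟨C, hTC, hC⟩ := hC
  -- A proper submodule meets T only in zero and therefore lies in C. Containment in C, unlike
  -- properness, is inherited by sums.
  have hle : (properSum k L M).toSubmodule ≤ C := by
    rw [properSum, LieSubmodule.sSup_toSubmodule]
    refine sSup_le ?_
    rintro _ ⟨P, hP, rfl⟩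
    refine hC _ (fun s hs => P.lie_mem hs) (Submodule.disjoint_def.2 fun t htP htT => ?_)
    by_contra h
    exact hP (hgen P t htT htP h)
  intro h
  refine hT (hTC.eq_bot_of_le ?_)
  rw [h] at hle
  exact fun t _ => hle (Submodule.mem_top (x := t))

variable [LieAlgebra k L] [LieModule k L M]

/-- The preimage of a proper submodule of the quotient is proper, so it is one of the summands of
`properSum` and has image zero. The hypothesis makes the quotient non-zero. -/
theorem irredQuot_isIrreducible (h : properSum k L M ≠ ⊤) :
    LieModule.IsIrreducible k L (IrredQuot k L M) := by
  have hnt : Nontrivial (IrredQuot k L M) := by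
    refine Submodule.Quotient.nontrivial_iff.2 fun h' => h ?_
    exact (LieSubmodule.toSubmodule_eq_top _).1 h'
  refine LieModule.IsIrreducible.mk fun N hN => ?_
  by_contra hne
  have h1 : N.comap (LieSubmodule.Quotient.mk' (properSum k L M)) ≤ properSum k L M := by
    refine le_sSup (a := N.comap (LieSubmodule.Quotient.mk' (properSum k L M))) fun htop => hne ?_
    refine top_le_iff.1 fun q _ => ?_
    obtain ⟨m, rfl⟩ := LieSubmodule.Quotient.surjective_mk' _ q
    have : m ∈ N.comap (LieSubmodule.Quotient.mk' (properSum k L M)) :=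
      htop ▸ LieSubmodule.mem_top m
    exact this
  refine hN (le_bot_iff.1 fun q hq => ?_)
  obtain ⟨m, rfl⟩ := LieSubmodule.Quotient.surjective_mk' _ q
  exact (LieSubmodule.Quotient.mk_eq_zero _).2 (h1 hq)

/-- An irreducible module to which `M` maps non-trivially is isomorphic to the irreducible
quotient of `M`. -/
theorem irredQuot_equiv {N : Type*} [AddCommGroup N] [Module k N] [LieRingModule L N]
    [LieModule k L N] [LieModule.IsIrreducible k L N] (h : properSum k L M ≠ ⊤)
    (g : M →ₗ⁅k,L⁆ N) (hg : g ≠ 0) : Nonempty (IrredQuot k L M ≃ₗ⁅k,L⁆ N) := by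
  have hrange : g.range = ⊤ := by
    refine (IsSimpleOrder.eq_bot_or_eq_top g.range).resolve_left fun hb => hg ?_
    ext m
    have : g m ∈ g.range := (LieModuleHom.mem_range g _).2 ⟨m, rfl⟩
    rw [hb] at this
    simpa using this
  have hsurj : Function.Surjective g := fun n => by
    have : n ∈ g.range := hrange ▸ LieSubmodule.mem_top n
    exact (LieModuleHom.mem_range g n).1 this
  have hker : g.ker ≤ properSum k L M := by
    refine le_sSup (a := g.ker) fun htop => hg ?_
    ext m
    have : m ∈ g.ker := htop ▸ LieSubmodule.mem_top m
    simpa using this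
  -- The image of `properSum` is zero or everything. In the second case `properSum`, which contains
  -- the kernel, would be the whole of M.
  have hker' : properSum k L M ≤ g.ker := by
    rcases IsSimpleOrder.eq_bot_or_eq_top ((properSum k L M).map g) with hb | ht
    · intro m hm
      have : g m ∈ (properSum k L M).map g := LieSubmodule.mem_map_of_mem hm
      rw [hb] at this
      simpa using this
    · refine absurd (top_le_iff.1 fun m _ => ?_) h
      have : g m ∈ (properSum k L M).map g := ht ▸ LieSubmodule.mem_top _
      obtain ⟨m', hm', he⟩ := (LieSubmodule.mem_map _).1 this
      have : m - m' ∈ g.ker := by simp [he]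
      simpa using add_mem (hker this) hm'
  let l : IrredQuot k L M →ₗ[k] N := Submodule.liftQ _ (g : M →ₗ[k] N) (fun m hm => hker' hm)
  have hl : ∀ m, l (LieSubmodule.Quotient.mk' (properSum k L M) m) = g m := fun m => rfl
  have hbij : Function.Bijective l := by
    constructor
    · refine (injective_iff_map_eq_zero l).2 fun q hq => ?_
      obtain ⟨m, rfl⟩ := LieSubmodule.Quotient.surjective_mk' _ q
      exact (LieSubmodule.Quotient.mk_eq_zero _).2 (hker ((hl m).symm.trans hq))
    · intro n
      obtain ⟨m, rfl⟩ := hsurj n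
      exact ⟨LieSubmodule.Quotient.mk' _ m, hl m⟩
  exact ⟨{ (LinearEquiv.ofBijective l hbij) with
    map_lie' := by
      intro x q
      obtain ⟨m, rfl⟩ := LieSubmodule.Quotient.surjective_mk' _ q
      change l ⁅x, LieSubmodule.Quotient.mk' (properSum k L M) m⁆ = ⁅x, l _⁆
      rw [← LieModuleHom.map_lie, hl, hl, LieModuleHom.map_lie] }⟩

end Irreducible

/-! ### Enveloping algebras and the universal property of induced modules -/

section Induced

variable {k L : Type*} [Field k] [LieRing L] [LieAlgebra k L]

local notation "U" => UniversalEnvelopingAlgebra k L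

/-- The elements with property P form a subalgebra S that contains the image of L. By the universal
property the map from L to S extends to U, and its composite with the inclusion is the identity, so
S is everything. -/
theorem envelopingAlgebra_induction {P : U → Prop} (u : U)
    (hal : ∀ c : k, P (algebraMap k U c)) (hι : ∀ x : L, P (UniversalEnvelopingAlgebra.ι k x))
    (hadd : ∀ a b, P a → P b → P (a + b)) (hmul : ∀ a b, P a → P b → P (a * b)) : P u := by
  let S : Subalgebra k U :=
    { carrier := {u | P u}
      mul_mem' := fun {a b} => hmul a b
      add_mem' := fun {a b} => hadd a b
      algebraMap_mem' := hal }
  let ι' : L →ₗ⁅k⁆ S :=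
    { toFun := fun x => ⟨UniversalEnvelopingAlgebra.ι k x, hι x⟩
      map_add' := fun x y => Subtype.ext (map_add _ x y)
      map_smul' := fun c x => Subtype.ext (map_smul _ c x)
      map_lie' := fun {x y} => Subtype.ext (LieHom.map_lie _ x y) }
  have h : S.val.comp (UniversalEnvelopingAlgebra.lift k ι') = AlgHom.id k U := by
    refine UniversalEnvelopingAlgebra.hom_ext k (LieHom.ext fun x => ?_)
    change ((UniversalEnvelopingAlgebra.lift k ι' (UniversalEnvelopingAlgebra.ι k x) : S) : U) =
      UniversalEnvelopingAlgebra.ι k x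
    rw [UniversalEnvelopingAlgebra.lift_ι_apply]
    rfl
  have h2 : ((UniversalEnvelopingAlgebra.lift k ι' u : S) : U) = u := DFunLike.congr_fun h u
  exact h2 ▸ (UniversalEnvelopingAlgebra.lift k ι' u).2

variable (B : LieSubalgebra k L) (N : Type*) [AddCommGroup N] [Module k N] [LieRingModule B N]

/-- A Lie submodule is stable under the whole enveloping algebra, and u ⊗ n is u applied to 1 ⊗ n.
-/
theorem Ind.eq_top_of_of_mem (P : LieSubmodule k L (Ind B N)) (h : ∀ n, Ind.of B N n ∈ P) :
    P = ⊤ := by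
  have hU : ∀ (u : U) (m : Ind B N), m ∈ P → u • m ∈ P := by
    intro u
    induction u using envelopingAlgebra_induction with
    | hal c => exact fun m hm => by rw [algebraMap_smul]; exact P.smul_mem c hm
    | hι x => exact fun m hm => P.lie_mem hm
    | hadd a b ha hb => exact fun m hm => by rw [add_smul]; exact add_mem (ha m hm) (hb m hm)
    | hmul a b ha hb => exact fun m hm => by rw [mul_smul]; exact ha _ (hb m hm)
  refine top_le_iff.1 fun m _ => ?_
  obtain ⟨z, rfl⟩ := Ind.proj_surjective B N m
  induction z using TensorProduct.induction_on with
  | zero => rw [map_zero]; exact zero_mem _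
  | add x y hx hy => rw [map_add]; exact add_mem (hx trivial) (hy trivial)
  | tmul u n =>
    have : Ind.proj B N (u ⊗ₜ n) = u • Ind.of B N n := by
      change _ = u • Ind.proj B N (1 ⊗ₜ n)
      rw [← map_smul, TensorProduct.smul_tmul', smul_eq_mul, mul_one]
    rw [this]
    exact hU u _ (h n)

variable {B N} {M : Type*} [AddCommGroup M] [Module k M] [LieRingModule L M] [LieModule k L M]

/-- The universal property of the induced module. -/
theorem Ind.exists_lift (F : N →ₗ[k] M) (hF : ∀ (b : B) (n : N), F ⁅b, n⁆ = ⁅(b : L), F n⁆) :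
    ∃ g : Ind B N →ₗ⁅k,L⁆ M, ∀ n, g (Ind.of B N n) = F n := by
  let ρ : U →ₐ[k] Module.End k M := UniversalEnvelopingAlgebra.lift k (LieModule.toEnd k L M)
  have hρ : ∀ x m, ρ (UniversalEnvelopingAlgebra.ι k x) m = ⁅x, m⁆ := fun x m => by
    rw [UniversalEnvelopingAlgebra.lift_ι_apply]; rfl
  -- The map u ⊗ n ↦ u · F(n). Its compatibility with the action of U reduces the vanishing on
  -- `indRel` to the generating relations, where it is the hypothesis on F.
  let G : U ⊗[k] N →ₗ[k] M := TensorProduct.lift ((LinearMap.lcomp k M F) ∘ₗ ρ.toLinearMap)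
  have hG : ∀ u n, G (u ⊗ₜ n) = ρ u (F n) := fun u n => rfl
  have hGs : ∀ u z, G (u • z) = ρ u (G z) := by
    intro u z
    induction z using TensorProduct.induction_on with
    | zero => simp
    | add x y hx hy => rw [smul_add, map_add, map_add, hx, hy, map_add]
    | tmul v n => rw [TensorProduct.smul_tmul', hG, hG, smul_eq_mul, map_mul]; rfl
  have hker : (indRel B N).restrictScalars k ≤ LinearMap.ker G := by
    intro z hz
    change G z = 0
    replace hz : z ∈ indRel B N := hz
    induction hz using Submodule.span_induction with
    | mem z h =>
      obtain ⟨b, n, rfl⟩ := h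
      rw [map_sub, hG, hG, hρ, map_one, hF]
      exact sub_self _
    | zero => simp
    | add x y _ _ hx hy => rw [map_add, hx, hy, add_zero]
    | smul u x _ hx => rw [hGs, hx, map_zero]
  let g : Ind B N →ₗ[k] M := Submodule.liftQ ((indRel B N).restrictScalars k) G hker
  have hg : ∀ z, g (Ind.proj B N z) = G z := fun z => rfl
  refine ⟨{ g with map_lie' := ?_ }, fun n => ?_⟩
  · intro x m
    obtain ⟨z, rfl⟩ := Ind.proj_surjective B N m
    change g ⁅x, _⁆ = ⁅x, g _⁆
    rw [Ind.lie_def, ← map_smul, hg, hg, hGs, hρ]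
  · change g (Ind.proj B N (1 ⊗ₜ n)) = F n
    rw [hg, hG, map_one]
    rfl

end Induced

/-! ### A model of the universal highest-weight module by differential operators -/

section FockModel

variable {k : Type*} [Field k]

open MvPolynomial

/-- Both sides are bilinear in (a, b), so a commutation relation between modes extends to all
Laurent polynomials. -/
theorem lie_laurent {V : Type*} [AddCommGroup V] [Module k V]
    (F G K : k[T;T⁻¹] →ₗ[k] Module.End k V)
    (h : ∀ m n : ℤ, ⁅F (LaurentPolynomial.T m), G (LaurentPolynomial.T n)⁆ =
      K (LaurentPolynomial.T (m + n))) (a b : k[T;T⁻¹]) : ⁅F a, G b⁆ = K (a * b) := by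
  induction a using laurent_induction with
  | hadd a a' h h' => simp only [add_mul, map_add, add_lie, h, h']
  | hsmul c a h => simp only [smul_mul_assoc, map_smul, smul_lie, h]
  | hT n =>
    induction b using laurent_induction with
    | hadd a a' h h' => simp only [mul_add, map_add, lie_add, h, h']
    | hsmul c a h => simp only [mul_smul_comm, map_smul, lie_smul, h]
    | hT m => rw [← LaurentPolynomial.T_add, h]

/-- An operator that commutes with all the variables is linear over the polynomial ring, hence
determined by its value at 1. The commutation relations below that do not involve f are checked by
this criterion. -/
theorem mvPolynomial_end_eq_zero {ι : Type*} (A : Module.End k (MvPolynomial ι k)) (h1 : A 1 = 0)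
    (hX : ∀ l p, A (X l * p) = X l * A p) : A = 0 := by
  ext1 s
  ext
  rw [LinearMap.zero_comp, LinearMap.comp_apply]
  change coeff _ (A (monomial s 1)) = coeff _ (0 : MvPolynomial ι k)
  congr 1
  generalize monomial s (1 : k) = p
  induction p using MvPolynomial.induction_on with
  | C a => rw [← mul_one (C a), ← smul_eq_C_mul, map_smul, h1, smul_zero]
  | add p q hp hq => rw [map_add, hp, hq, add_zero]
  | mul_X p i hp => rw [mul_comm, hX, hp, mul_zero]

/-- The derivation `X m ↦ X (m + n)`. -/
def shiftDer (n : ℤ) : Derivation k (MvPolynomial ℤ k) (MvPolynomial ℤ k) :=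
  mkDerivation k fun m => X (m + n)

/-- The second order operator `∑ X (m + l + n) ∂ₘ ∂ₗ`, with the sum over `m` and `l` in `S`. -/
def quadOpOn (S : Finset ℤ) (n : ℤ) : Module.End k (MvPolynomial ℤ k) :=
  ∑ m ∈ S, ∑ l ∈ S, (LinearMap.mulLeft k (X (m + l + n))) ∘ₗ
    (pderiv m).toLinearMap ∘ₗ (pderiv l).toLinearMap

theorem quadOpOn_apply (S : Finset ℤ) (n : ℤ) (p : MvPolynomial ℤ k) :
    quadOpOn S n p = ∑ m ∈ S, ∑ l ∈ S, X (m + l + n) * pderiv m (pderiv l p) := by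
  simp [quadOpOn, LinearMap.sum_apply]

/-- Derivatives in variables that do not occur in p vanish, so enlarging the index set changes
nothing. This gives the infinite sum in `quadOp` a meaning. -/
theorem quadOpOn_eq {S : Finset ℤ} (n : ℤ) {p : MvPolynomial ℤ k} (h : p.vars ⊆ S) :
    quadOpOn S n p = quadOpOn p.vars n p := by
  have hz : ∀ m l, l ∉ p.vars → pderiv m (pderiv l p) = 0 := fun m l hl => by
    rw [pderiv_eq_zero_of_notMem_vars hl, map_zero]
  -- Partial derivatives commute, so the outer index can be restricted in the same way as the inner
  -- one.
  have hc : ∀ m l, pderiv m (pderiv l p) = pderiv l (pderiv m p) := fun m l => by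
    have : ⁅(pderiv m : Derivation k (MvPolynomial ℤ k) (MvPolynomial ℤ k)), (pderiv l : Derivation k (MvPolynomial ℤ k) (MvPolynomial ℤ k))⁆ = 0 := by
      refine derivation_ext fun i => ?_
      rw [Derivation.commutator_apply]
      simp [pderiv_X, Pi.single_apply, apply_ite]
    have := DFunLike.congr_fun this p
    rwa [Derivation.commutator_apply, Derivation.zero_apply, sub_eq_zero] at this
  rw [quadOpOn_apply, quadOpOn_apply]
  symm
  refine (Finset.sum_subset h fun m _ hm => ?_).trans (Finset.sum_congr rfl fun m _ => ?_)
  · exact Finset.sum_eq_zero fun l _ => by rw [hc, hz l m hm, mul_zero]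
  · exact Finset.sum_subset h fun l _ hl => by rw [hz m l hl, mul_zero]

/-- The second order operator `∑ X (m + l + n) ∂ₘ ∂ₗ`, with the sum over all `m` and `l`. -/
def quadOp (n : ℤ) : Module.End k (MvPolynomial ℤ k) where
  toFun p := quadOpOn p.vars n p
  map_add' p q := by
    classical
    -- All three terms are computed over one common finite index set, on which the operator is
    -- linear.
    rw [← quadOpOn_eq n (S := p.vars ∪ q.vars ∪ (p + q).vars) (by intro; simp; tauto),
      ← quadOpOn_eq n (S := p.vars ∪ q.vars ∪ (p + q).vars) (p := p) (by intro; simp; tauto),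
      ← quadOpOn_eq n (S := p.vars ∪ q.vars ∪ (p + q).vars) (p := q) (by intro; simp; tauto),
      map_add]
  map_smul' c p := by
    classical
    rw [← quadOpOn_eq n (S := p.vars ∪ (c • p).vars) (by intro; simp; tauto),
      ← quadOpOn_eq n (S := p.vars ∪ (c • p).vars) (p := p) (by intro; simp; tauto), map_smul]
    rfl

/-- Two derivations that agree on the variables in S agree on every polynomial in those variables.
-/
theorem shiftDer_eq_sum {S : Finset ℤ} (n : ℤ) {p : MvPolynomial ℤ k} (h : p.vars ⊆ S) :
    shiftDer n p = ∑ l ∈ S, X (l + n) * pderiv l p := by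
  have h1 : shiftDer n p =
      (∑ l ∈ S, (X (l + n) : MvPolynomial ℤ k) • pderiv l :
        Derivation k (MvPolynomial ℤ k) (MvPolynomial ℤ k)) p := by
    refine derivation_eqOn_supported (s := (S : Set ℤ)) ?_ (mem_supported.2 (by exact_mod_cast h))
    rintro i hi
    simp only [Function.comp_apply, shiftDer, mkDerivation_X]
    rw [← Derivation.coeFnAddMonoidHom_apply, map_sum, Finset.sum_apply]
    simp only [Derivation.coeFnAddMonoidHom_apply, Derivation.smul_apply, pderiv_X,
      Pi.single_apply, smul_eq_mul, mul_ite, mul_one, mul_zero]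
    rw [Finset.sum_ite_eq S i]
    simp [show i ∈ S from hi]
  rw [h1, ← Derivation.coeFnAddMonoidHom_apply, map_sum, Finset.sum_apply]
  rfl

/-- The Leibniz rule, used twice, gives two cross terms, one for each derivative that hits X m. They
are equal because X (m + l + n) is symmetric in m and l, whence the factor 2. -/
theorem quadOpOn_X_mul {S : Finset ℤ} (n m : ℤ) (hm : m ∈ S) (p : MvPolynomial ℤ k) :
    quadOpOn S n (X m * p) =
      X m * quadOpOn S n p + (2 : k) • ∑ l ∈ S, X (l + (n + m)) * pderiv l p := by
  have hd₁ : ∀ j (q : MvPolynomial ℤ k), pderiv j (X m * q) =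
      X m * pderiv j q + if j = m then q else 0 := by
    intro j q
    rw [pderiv_mul, pderiv_X, Pi.single_apply, ite_mul, one_mul, zero_mul, add_comm]
    simp only [eq_comm]
  have hd : ∀ i j, X (i + j + n) * pderiv i (pderiv j (X m * p)) =
      X m * (X (i + j + n) * pderiv i (pderiv j p)) +
      (if i = m then X (m + j + n) * pderiv j p else 0) +
      (if j = m then X (i + m + n) * pderiv i p else 0) := by
    intro i j
    rw [hd₁, map_add, hd₁, apply_ite (pderiv i), map_zero, mul_add, mul_add, mul_ite, mul_ite,
      mul_zero, mul_left_comm]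
    congr 1
    · congr 1
      split_ifs with h
      · rw [h]
      · rfl
    · split_ifs with h
      · rw [h]
      · rfl
  simp only [quadOpOn_apply, hd, Finset.sum_add_distrib]
  have h₁ : ∑ i ∈ S, ∑ j ∈ S, (if i = m then X (m + j + n) * pderiv j p else 0) =
      ∑ l ∈ S, X (l + (n + m)) * pderiv l p := by
    rw [Finset.sum_comm]
    refine Finset.sum_congr rfl fun l _ => ?_
    rw [Finset.sum_ite_eq', if_pos hm]
    congr 2
    ring
  have h₂ : ∑ i ∈ S, ∑ j ∈ S, (if j = m then X (i + m + n) * pderiv i p else 0) =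
      ∑ l ∈ S, X (l + (n + m)) * pderiv l p := by
    refine Finset.sum_congr rfl fun l _ => ?_
    rw [Finset.sum_ite_eq', if_pos hm]
    congr 2
    ring
  rw [h₁, h₂, add_assoc, two_smul]
  simp only [Finset.mul_sum]

theorem quadOp_X_mul (n m : ℤ) (p : MvPolynomial ℤ k) :
    quadOp n (X m * p) = X m * quadOp n p + (2 : k) • shiftDer (n + m) p := by
  classical
  obtain ⟨S, hm, hp, hq⟩ : ∃ S : Finset ℤ, m ∈ S ∧ p.vars ⊆ S ∧
      (X m * p : MvPolynomial ℤ k).vars ⊆ S :=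
    ⟨insert m (p.vars ∪ (X m * p : MvPolynomial ℤ k).vars), Finset.mem_insert_self _ _,
      Finset.subset_union_left.trans (Finset.subset_insert _ _),
      Finset.subset_union_right.trans (Finset.subset_insert _ _)⟩
  have h1 : quadOp n (X m * p) = quadOpOn S n (X m * p) := (quadOpOn_eq n hq).symm
  have h2 : quadOp n p = quadOpOn S n p := (quadOpOn_eq n hp).symm
  rw [h1, h2, shiftDer_eq_sum (n + m) hp, quadOpOn_X_mul n m hm]

variable (φ : ℤ → k)

/-- The operator by which `h ⊗ t ^ n` acts on the polynomial model of the universal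
highest-weight module. -/
def fockH (n : ℤ) : Module.End k (MvPolynomial ℤ k) :=
  φ n • LinearMap.id - (2 : k) • (shiftDer n).toLinearMap

/-- The operator by which `e ⊗ t ^ n` acts on the polynomial model. -/
def fockE (n : ℤ) : Module.End k (MvPolynomial ℤ k) :=
  (mkDerivation k fun m => C (φ (n + m))).toLinearMap - quadOp n

/-- The operator by which `f ⊗ t ^ n` acts on the polynomial model. -/
def fockF (n : ℤ) : Module.End k (MvPolynomial ℤ k) := LinearMap.mulLeft k (X n)

/-- This rule and `fockE_X_mul`, with the values at 1, are the straightening rules for moving h ⊗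
t^n and e ⊗ t^n past f ⊗ t^m = X m towards the highest-weight vector 1. They determine both
operators, and the relations below use nothing else about them. -/
theorem fockH_X_mul (n m : ℤ) (p : MvPolynomial ℤ k) :
    fockH φ n (X m * p) = X m * fockH φ n p - (2 : k) • (X (m + n) * p) := by
  simp only [fockH, LinearMap.sub_apply, LinearMap.smul_apply, LinearMap.id_apply,
    Derivation.coeFn_coe, Derivation.leibniz, shiftDer,
    mkDerivation_X, smul_eq_mul, smul_eq_C_mul]
  ring

theorem fockE_X_mul (n m : ℤ) (p : MvPolynomial ℤ k) :
    fockE φ n (X m * p) = X m * fockE φ n p + fockH φ (n + m) p := by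
  simp only [fockE, fockH, LinearMap.sub_apply, LinearMap.smul_apply, LinearMap.id_apply,
    Derivation.coeFn_coe, Derivation.leibniz, quadOp_X_mul,
    mkDerivation_X, smul_eq_mul, smul_eq_C_mul]
  ring

theorem fockH_one (n : ℤ) : fockH φ n 1 = C (φ n) := by
  simp [fockH, smul_eq_C_mul]

theorem fockE_one (n : ℤ) : fockE φ n 1 = 0 := by
  have : quadOp n (1 : MvPolynomial ℤ k) = 0 := by
    change quadOpOn _ n 1 = 0
    simp [quadOpOn_apply]
  simp [fockE, this]

theorem fockH_C (n : ℤ) (c : k) : fockH φ n (C c) = C c * C (φ n) := by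
  conv_lhs => rw [← mul_one (C c), ← smul_eq_C_mul, map_smul, fockH_one, smul_eq_C_mul]

theorem fockE_C (n : ℤ) (c : k) : fockE φ n (C c) = 0 := by
  rw [← mul_one (C c), ← smul_eq_C_mul, map_smul, fockE_one, smul_zero]

/-- The terms that arise when both operators are moved past X l are symmetric under exchanging n and
m, so the commutator commutes with X l. -/
theorem fock_HH (n m : ℤ) : ⁅fockH φ n, fockH φ m⁆ = 0 := by
  refine mvPolynomial_end_eq_zero _ ?_ fun l p => ?_
  · simp only [LieRing.of_associative_ring_bracket, LinearMap.sub_apply, Module.End.mul_apply,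
      fockH_one, fockH_C]
    ring
  · simp only [LieRing.of_associative_ring_bracket, LinearMap.sub_apply, Module.End.mul_apply,
      fockH_X_mul, map_sub, map_smul]
    rw [show l + m + n = l + n + m by ring]
    simp only [smul_eq_C_mul]
    ring

theorem fock_HH_apply (n m : ℤ) (p : MvPolynomial ℤ k) :
    fockH φ n (fockH φ m p) = fockH φ m (fockH φ n p) := by
  have := LinearMap.congr_fun (fock_HH φ n m) p
  simpa [LieRing.of_associative_ring_bracket, sub_eq_zero] using this

theorem fock_HF (n m : ℤ) : ⁅fockH φ n, fockF (k := k) m⁆ = -((2 : k) • fockF (n + m)) := by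
  refine LinearMap.ext fun p => ?_
  simp only [LieRing.of_associative_ring_bracket, LinearMap.sub_apply, Module.End.mul_apply,
    fockF, LinearMap.mulLeft_apply, fockH_X_mul, LinearMap.neg_apply, LinearMap.smul_apply]
  rw [add_comm n m]
  ring

theorem fock_EF (n m : ℤ) : ⁅fockE φ n, fockF (k := k) m⁆ = fockH φ (n + m) := by
  refine LinearMap.ext fun p => ?_
  simp only [LieRing.of_associative_ring_bracket, LinearMap.sub_apply, Module.End.mul_apply,
    fockF, LinearMap.mulLeft_apply, fockE_X_mul]
  ring

/-- Moving both sides past X l leaves the correction 2 `fockH` at n + m + l on each of them,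
provided the `fockH` operators commute with one another. -/
theorem fock_HE (n m : ℤ) : ⁅fockH φ n, fockE φ m⁆ = (2 : k) • fockE φ (n + m) := by
  rw [← sub_eq_zero]
  refine mvPolynomial_end_eq_zero _ ?_ fun l p => ?_
  · simp only [LieRing.of_associative_ring_bracket, LinearMap.sub_apply, Module.End.mul_apply,
      fockH_one, fockE_one, fockE_C, map_zero, LinearMap.smul_apply, smul_zero, sub_zero]
  · simp only [LieRing.of_associative_ring_bracket, LinearMap.sub_apply, Module.End.mul_apply,
      fockH_X_mul, fockE_X_mul, map_sub, map_add, map_smul, LinearMap.smul_apply,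
      fock_HH_apply φ n (m + l)]
    rw [show m + (l + n) = n + m + l by ring]
    simp only [smul_eq_C_mul]
    ring

theorem fock_HE_apply (n m : ℤ) (p : MvPolynomial ℤ k) :
    fockH φ n (fockE φ m p) = fockE φ m (fockH φ n p) + (2 : k) • fockE φ (n + m) p := by
  have := LinearMap.congr_fun (fock_HE φ n m) p
  simp only [LieRing.of_associative_ring_bracket, LinearMap.sub_apply, Module.End.mul_apply,
    LinearMap.smul_apply] at this
  rw [← this]
  abel

/-- Moving the commutator past X l leaves the difference of [H_(n+l), E_m] and [H_(m+l), E_n]. Both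
equal 2 E_(n+m+l) by `fock_HE`. -/
theorem fock_EE (n m : ℤ) : ⁅fockE φ n, fockE φ m⁆ = 0 := by
  refine mvPolynomial_end_eq_zero _ ?_ fun l p => ?_
  · simp only [LieRing.of_associative_ring_bracket, LinearMap.sub_apply, Module.End.mul_apply,
      fockE_one, map_zero, sub_zero]
  · simp only [LieRing.of_associative_ring_bracket, LinearMap.sub_apply, Module.End.mul_apply,
      fockE_X_mul, map_add, fock_HE_apply]
    rw [show n + l + m = m + l + n by ring]
    simp only [smul_eq_C_mul]
    ring

theorem fock_FF (n m : ℤ) : ⁅fockF (k := k) n, fockF (k := k) m⁆ = 0 := by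
  refine LinearMap.ext fun p => ?_
  simp only [LieRing.of_associative_ring_bracket, LinearMap.sub_apply, Module.End.mul_apply,
    fockF, LinearMap.mulLeft_apply, LinearMap.zero_apply]
  rw [mul_left_comm, sub_self]

end FockModel

/-! ### Triangular decomposition of the loop algebra -/

section Triangular

variable (k : Type*) [Field k]

/-- The element of `sl₂` with the given matrix of trace zero. -/
def Sl2.ofMat (A : Matrix (Fin 2) (Fin 2) k) (hA : A.trace = 0) : Sl2 k :=
  (⟨A, hA⟩ : LieAlgebra.SpecialLinear.sl (Fin 2) k)

theorem Sl2.mat_ofMat (A : Matrix (Fin 2) (Fin 2) k) (hA : A.trace = 0) :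
    Sl2.mat k (Sl2.ofMat k A hA) = A := rfl

/-- The standard basis element `e` of `sl₂`. -/
def Sl2.e : Sl2 k := Sl2.ofMat k !![0, 1; 0, 0] (by simp [Matrix.trace_fin_two])

/-- The standard basis element `f` of `sl₂`. -/
def Sl2.f : Sl2 k := Sl2.ofMat k !![0, 0; 1, 0] (by simp [Matrix.trace_fin_two])

/-- The standard basis element `h` of `sl₂`. -/
def Sl2.h : Sl2 k := Sl2.ofMat k !![1, 0; 0, -1] (by simp [Matrix.trace_fin_two])

variable {k}

theorem Sl2.mat_injective : Function.Injective (Sl2.mat k) := Subtype.val_injective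

theorem Sl2.mat_one_one (x : Sl2 k) : Sl2.mat k x 1 1 = - Sl2.mat k x 0 0 := by
  have h : (Sl2.mat k x).trace = 0 := x.2
  rw [Matrix.trace_fin_two] at h
  linear_combination h

theorem Sl2.eq_basis (x : Sl2 k) : x = Sl2.mat k x 0 1 • Sl2.e k + Sl2.mat k x 1 0 • Sl2.f k +
    Sl2.mat k x 0 0 • Sl2.h k := by
  refine Sl2.mat_injective ?_
  simp only [map_add, map_smul, Sl2.e, Sl2.f, Sl2.h, Sl2.mat_ofMat]
  ext i j
  fin_cases i <;> fin_cases j <;> simp [Sl2.mat_one_one]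

namespace Loop

theorem entry_one_one (z : Loop k) : entry 1 1 z = - entry 0 0 z := by
  induction z using Loop.induction with
  | h0 => simp
  | hadd x y hx hy => rw [map_add, map_add, hx, hy, neg_add]
  | hmk x a => rw [entry_mk, entry_mk, Sl2.mat_one_one, neg_smul]

theorem mk_add_left (x y : Sl2 k) (a : k[T;T⁻¹]) : mk (x + y) a = mk x a + mk y a :=
  TensorProduct.tmul_add _ _ _

theorem mk_smul_left (c : k) (x : Sl2 k) (a : k[T;T⁻¹]) : mk (c • x) a = mk x (c • a) :=
  (TensorProduct.smul_tmul _ _ _).symm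

theorem eq_basis (z : Loop k) : z = mk (Sl2.e k) (entry 0 1 z) + mk (Sl2.f k) (entry 1 0 z) +
    mk (Sl2.h k) (entry 0 0 z) := by
  induction z using Loop.induction with
  | h0 => simp [mk, TensorProduct.zero_tmul]; rfl
  | hadd x y hx hy =>
    simp only [map_add, mk_add]
    nth_rw 1 [hx, hy]
    abel
  | hmk x a =>
    nth_rw 1 [Sl2.eq_basis x]
    simp only [mk_add_left, mk_smul_left, entry_mk]

theorem entry_ext {x y : Loop k} (h₁ : entry 0 1 x = entry 0 1 y)
    (h₂ : entry 1 0 x = entry 1 0 y) (h₃ : entry 0 0 x = entry 0 0 y) : x = y := by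
  rw [eq_basis x, eq_basis y, h₁, h₂, h₃]

@[simp] theorem entry_mk_e (a : k[T;T⁻¹]) :
    entry 0 0 (mk (Sl2.e k) a) = 0 ∧ entry 0 1 (mk (Sl2.e k) a) = a ∧
      entry 1 0 (mk (Sl2.e k) a) = 0 := by
  simp [entry_mk, Sl2.e, Sl2.mat_ofMat]

@[simp] theorem entry_mk_f (a : k[T;T⁻¹]) :
    entry 0 0 (mk (Sl2.f k) a) = 0 ∧ entry 0 1 (mk (Sl2.f k) a) = 0 ∧
      entry 1 0 (mk (Sl2.f k) a) = a := by
  simp [entry_mk, Sl2.f, Sl2.mat_ofMat]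

@[simp] theorem entry_mk_h (a : k[T;T⁻¹]) :
    entry 0 0 (mk (Sl2.h k) a) = a ∧ entry 0 1 (mk (Sl2.h k) a) = 0 ∧
      entry 1 0 (mk (Sl2.h k) a) = 0 := by
  simp [entry_mk, Sl2.h, Sl2.mat_ofMat]

variable (k) in
/-- The strictly lower triangular elements. -/
def lower : Submodule k (Loop k) := LinearMap.ker (entry 0 0) ⊓ LinearMap.ker (entry 0 1)

variable (k) in
/-- The diagonal elements. -/
def diag : Submodule k (Loop k) := LinearMap.ker (entry 0 1) ⊓ LinearMap.ker (entry 1 0)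

variable (k) in
/-- The strictly upper triangular elements. -/
def upper : Submodule k (Loop k) := LinearMap.ker (entry 0 0) ⊓ LinearMap.ker (entry 1 0)

theorem mem_lower {x : Loop k} : x ∈ lower k ↔ entry 0 0 x = 0 ∧ entry 0 1 x = 0 := Iff.rfl

theorem mem_diag {x : Loop k} : x ∈ diag k ↔ entry 0 1 x = 0 ∧ entry 1 0 x = 0 := Iff.rfl

theorem mem_upper {x : Loop k} : x ∈ upper k ↔ entry 0 0 x = 0 ∧ entry 1 0 x = 0 := Iff.rfl

theorem exists_triangular (x : Loop k) :
    ∃ a ∈ lower k, ∃ b ∈ diag k, ∃ c ∈ upper k, a + b + c = x := by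
  refine ⟨mk (Sl2.f k) (entry 1 0 x), by simp [mem_lower], mk (Sl2.h k) (entry 0 0 x),
    by simp [mem_diag], mk (Sl2.e k) (entry 0 1 x), by simp [mem_upper], ?_⟩
  conv_rhs => rw [eq_basis x]
  abel

theorem diag_lie_lower {x y : Loop k} (hx : x ∈ diag k) (hy : y ∈ lower k) :
    ⁅x, y⁆ ∈ lower k := by
  rw [mem_diag] at hx
  rw [mem_lower] at hy ⊢
  simp [entry_lie, hx, hy]

theorem upper_lie_lower {x y : Loop k} (hx : x ∈ upper k) (hy : y ∈ lower k) :
    ⁅x, y⁆ ∈ diag k := by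
  rw [mem_upper] at hx
  rw [mem_lower] at hy
  rw [mem_diag]
  simp [entry_lie, hx, hy, entry_one_one]

theorem h_lie_lower {y : Loop k} (hy : y ∈ lower k) :
    ⁅mk (Sl2.h k) 1, y⁆ = (-2 : k) • y := by
  rw [mem_lower] at hy
  refine entry_ext ?_ ?_ ?_
  · simp [entry_lie, hy, entry_one_one]
  · simp [entry_lie, hy, entry_one_one, two_smul]
    ring
  · simp [entry_lie, hy]

theorem diag_le_borel {x : Loop k} (hx : x ∈ diag k) : x ∈ borel k := hx.2

theorem upper_le_borel {x : Loop k} (hx : x ∈ upper k) : x ∈ borel k := hx.2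

theorem h_mem_diag (a : k[T;T⁻¹]) : mk (Sl2.h k) a ∈ diag k := by simp [mem_diag]

end Loop

end Triangular

/-! ### Highest-weight modules of the loop algebra and irreducibility of L(φ) -/

section HighestWeight

variable {k : Type*} [Field k] (φ : ℤ → k)

open Loop

theorem Weight.exists_eq_smul_gen (n : Weight φ) : ∃ c : k, n = c • Weight.gen φ :=
  ⟨n, (mul_one (show k from n)).symm⟩

/-- The highest weight vector of the universal highest weight module. -/
def Verma.hwv : Verma φ := Ind.of (borel k) (Weight φ) (Weight.gen φ)

theorem Verma.lie_hwv {x : Loop k} (hx : x ∈ borel k) :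
    ⁅x, Verma.hwv φ⁆ = evalAt φ (entry 0 0 x) • Verma.hwv φ := by
  have := Ind.of_lie (borel k) (Weight φ) ⟨x, hx⟩ (Weight.gen φ)
  rw [Weight.lie_def, map_smul] at this
  exact this.symm

theorem Verma.eq_top {P : LieSubmodule k (Loop k) (Verma φ)} (hP : Verma.hwv φ ∈ P) : P = ⊤ := by
  refine Ind.eq_top_of_of_mem _ _ P fun n => ?_
  obtain ⟨c, rfl⟩ := Weight.exists_eq_smul_gen φ n
  rw [map_smul]
  exact P.smul_mem _ hP

theorem LoopIrred.hwv_eq :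
    LoopIrred.hwv φ = LieSubmodule.Quotient.mk' (properSum k (Loop k) (Verma φ)) (Verma.hwv φ) :=
  rfl

theorem LoopIrred.lie_hwv {x : Loop k} (hx : x ∈ borel k) :
    ⁅x, LoopIrred.hwv φ⁆ = evalAt φ (entry 0 0 x) • LoopIrred.hwv φ := by
  rw [LoopIrred.hwv_eq, ← LieModuleHom.map_lie, Verma.lie_hwv φ hx, map_smul]

theorem LoopIrred.eq_top {P : LieSubmodule k (Loop k) (LoopIrred φ)}
    (hP : LoopIrred.hwv φ ∈ P) : P = ⊤ := by
  have h := Verma.eq_top φ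
    (P := P.comap (LieSubmodule.Quotient.mk' (properSum k (Loop k) (Verma φ)))) hP
  refine top_le_iff.1 fun q _ => ?_
  obtain ⟨m, rfl⟩ := LieSubmodule.Quotient.surjective_mk' _ q
  have : m ∈ P.comap (LieSubmodule.Quotient.mk' (properSum k (Loop k) (Verma φ))) :=
    h ▸ LieSubmodule.mem_top m
  exact this

-- This is the general weight argument with T the line through v, on which h ⊗ 1 acts by φ(0). It is
-- stated for any cyclic highest-weight module because it serves both the universal one and L(φ).
variable {φ} in
theorem Loop.exists_weight_complement [CharZero k] {M : Type*} [AddCommGroup M] [Module k M]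
    [LieRingModule (Loop k) M] [LieModule k (Loop k) M] (v : M)
    (hv : ∀ x ∈ borel k, ⁅x, v⁆ = evalAt φ (entry 0 0 x) • v)
    (hgen : ∀ P : LieSubmodule k (Loop k) M, v ∈ P → P = ⊤) :
    ∃ C : Submodule k M, Disjoint (k ∙ v) C ∧
      ∀ S : Submodule k M, (∀ s ∈ S, ⁅mk (Sl2.h k) 1, s⁆ ∈ S) → Disjoint S (k ∙ v) → S ≤ C := by
  refine LoopSl2.exists_weight_complement (lower k) (diag k) (upper k) ?_
    (fun x hx y hy => diag_lie_lower hx hy) (fun x hx y hy => upper_lie_lower hx hy) _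
    (fun y hy => h_lie_lower hy) _ ?_ ?_ (evalAt φ 1) ?_ ?_
  · refine top_le_iff.1 fun x _ => ?_
    obtain ⟨a, ha, b, hb, c, hc, rfl⟩ := exists_triangular x
    exact Submodule.add_mem_sup (Submodule.add_mem_sup ha hb) hc
  · intro x hx t ht
    obtain ⟨c, rfl⟩ := Submodule.mem_span_singleton.1 ht
    rw [lie_smul, hv x (diag_le_borel hx)]
    exact Submodule.smul_mem _ _ (Submodule.smul_mem _ _ (Submodule.mem_span_singleton_self v))
  · intro x hx t ht
    obtain ⟨c, rfl⟩ := Submodule.mem_span_singleton.1 ht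
    rw [lie_smul, hv x (upper_le_borel hx), (mem_upper.1 hx).1, map_zero, zero_smul, smul_zero]
  · intro t ht
    obtain ⟨c, rfl⟩ := Submodule.mem_span_singleton.1 ht
    rw [lie_smul, hv _ (diag_le_borel (h_mem_diag 1)), (entry_mk_h (k := k) 1).1, smul_comm]
  · exact fun P hP => hgen P (hP (Submodule.mem_span_singleton_self v))

/-- The action of the loop algebra on the polynomial model of the universal highest weight
module. -/
def fockAct : Loop k →ₗ⁅k⁆ Module.End k (MvPolynomial ℤ k) where
  toLinearMap := laurentLift (fockE φ) ∘ₗ entry 0 1 + laurentLift fockF ∘ₗ entry 1 0 +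
    laurentLift (fockH φ) ∘ₗ entry 0 0
  map_lie' {x y} := by
    have hEE := lie_laurent (laurentLift (fockE φ)) (laurentLift (fockE φ)) 0
      fun m n => by simpa using fock_EE φ m n
    have hFF := lie_laurent (k := k) (laurentLift fockF) (laurentLift fockF) 0
      fun m n => by simpa using fock_FF m n
    have hHH := lie_laurent (laurentLift (fockH φ)) (laurentLift (fockH φ)) 0
      fun m n => by simpa using fock_HH φ m n
    have hEF := lie_laurent (laurentLift (fockE φ)) (laurentLift fockF) (laurentLift (fockH φ))
      fun m n => by simpa using fock_EF φ m n
    have hHF := lie_laurent (laurentLift (fockH φ)) (laurentLift fockF)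
      (-((2 : k) • laurentLift fockF)) fun m n => by simpa using fock_HF φ m n
    have hHE := lie_laurent (laurentLift (fockH φ)) (laurentLift (fockE φ))
      ((2 : k) • laurentLift (fockE φ)) fun m n => by simpa using fock_HE φ m n
    have hFE : ∀ a b : k[T;T⁻¹], ⁅laurentLift (k := k) fockF a, laurentLift (fockE φ) b⁆ =
        -laurentLift (fockH φ) (b * a) := fun a b => by rw [← lie_skew, hEF]
    have hFH : ∀ a b : k[T;T⁻¹], ⁅laurentLift (k := k) fockF a, laurentLift (fockH φ) b⁆ =
        (2 : k) • laurentLift fockF (b * a) := fun a b => by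
      rw [← lie_skew, hHF, LinearMap.neg_apply, neg_neg, LinearMap.smul_apply]
    have hEH : ∀ a b : k[T;T⁻¹], ⁅laurentLift (fockE φ) a, laurentLift (fockH φ) b⁆ =
        -((2 : k) • laurentLift (fockE φ) (b * a)) := fun a b => by
      rw [← lie_skew, hHE, LinearMap.smul_apply]
    simp only [AddHom.toFun_eq_coe, LinearMap.coe_toAddHom, LinearMap.add_apply,
      LinearMap.comp_apply, add_lie, lie_add, hEE, hFF, hHH, hEF, hHF, hHE, hFE, hFH, hEH,
      entry_lie, Fin.sum_univ_two, entry_one_one, LinearMap.zero_apply, LinearMap.neg_apply,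
      map_add, map_sub, mul_neg, neg_mul, map_neg, two_smul]
    -- With all brackets expanded, the two sides differ only in the order of the factors inside
    -- products of entries.
    rw [mul_comm (entry 0 0 y) (entry 0 0 x), mul_comm (entry 0 1 x) (entry 0 0 y),
      mul_comm (entry 0 1 y) (entry 0 0 x), mul_comm (entry 1 0 x) (entry 0 0 y),
      mul_comm (entry 1 0 y) (entry 0 0 x)]
    abel

theorem fockAct_one {x : Loop k} (hx : x ∈ borel k) :
    fockAct φ x 1 = evalAt φ (entry 0 0 x) • 1 := by
  have hE : ∀ a : k[T;T⁻¹], laurentLift (fockE φ) a 1 = 0 := by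
    intro a
    induction a using laurent_induction with
    | hadd a b ha hb => rw [map_add, LinearMap.add_apply, ha, hb, add_zero]
    | hsmul c a ha => rw [map_smul, LinearMap.smul_apply, ha, smul_zero]
    | hT n => rw [laurentLift_T, fockE_one]
  have hH : ∀ a : k[T;T⁻¹], laurentLift (fockH φ) a 1 = evalAt φ a • 1 := by
    intro a
    induction a using laurent_induction with
    | hadd a b ha hb => rw [map_add, LinearMap.add_apply, ha, hb, map_add, add_smul]
    | hsmul c a ha => rw [map_smul, LinearMap.smul_apply, ha, map_smul, smul_assoc]
    | hT n =>
      rw [evalAt, laurentLift_T, laurentLift_T, fockH_one, MvPolynomial.smul_eq_C_mul, mul_one]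
  change laurentLift (fockE φ) (entry 0 1 x) 1 + laurentLift fockF (entry 1 0 x) 1 +
    laurentLift (fockH φ) (entry 0 0 x) 1 = _
  rw [hE, hH, mem_borel.1 hx, map_zero, LinearMap.zero_apply, add_zero, zero_add]

/-- The constant 1 is a highest-weight vector of weight φ in the polynomial model, so the universal
property gives a homomorphism that sends the generator to 1. -/
theorem Verma.hwv_ne_zero : Verma.hwv φ ≠ 0 := by
  let : LieRingModule (Loop k) (MvPolynomial ℤ k) :=
    LieRingModule.compLieHom (MvPolynomial ℤ k) (fockAct φ)
  have : LieModule k (Loop k) (MvPolynomial ℤ k) :=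
    LieModule.compLieHom (MvPolynomial ℤ k) (fockAct φ)
  let F : Weight φ →ₗ[k] MvPolynomial ℤ k := LinearMap.toSpanSingleton k _ 1
  obtain ⟨g, hg⟩ := Ind.exists_lift (B := borel k) F (by
    intro b n
    obtain ⟨c, rfl⟩ := Weight.exists_eq_smul_gen φ n
    have h1 : F (Weight.gen φ) = 1 := one_smul k _
    rw [Weight.lie_def, map_smul, map_smul, h1, lie_smul]
    change _ = c • fockAct φ b 1
    rw [fockAct_one φ b.2, smul_comm])
  intro h
  have h1 := hg (Weight.gen φ)
  change g (Verma.hwv φ) = (1 : k) • 1 at h1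
  rw [h, map_zero, one_smul] at h1
  exact zero_ne_one h1

variable [CharZero k]

theorem Verma.properSum_ne_top : properSum k (Loop k) (Verma φ) ≠ ⊤ := by
  refine LoopSl2.properSum_ne_top (T := k ∙ Verma.hwv φ) ?_
    (Loop.exists_weight_complement (φ := φ) _ (fun x hx => Verma.lie_hwv φ hx)
      fun P hP => Verma.eq_top φ hP) fun P t ht htP h => ?_
  · simpa using Verma.hwv_ne_zero φ
  · obtain ⟨c, rfl⟩ := Submodule.mem_span_singleton.1 ht
    refine Verma.eq_top φ ((P.toSubmodule.smul_mem_iff (s := c) ?_).1 htP)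
    rintro rfl
    exact h (zero_smul _ _)

theorem LoopIrred.isIrreducible : LieModule.IsIrreducible k (Loop k) (LoopIrred φ) :=
  irredQuot_isIrreducible (Verma.properSum_ne_top φ)

theorem LoopIrred.hwv_ne_zero : LoopIrred.hwv φ ≠ 0 := by
  intro h
  rw [LoopIrred.hwv_eq, LieSubmodule.Quotient.mk_eq_zero] at h
  exact Verma.properSum_ne_top φ (Verma.eq_top φ h)

theorem LoopIrred.exists_weight_complement :
    ∃ C : Submodule k (LoopIrred φ), Disjoint (k ∙ LoopIrred.hwv φ) C ∧
      ∀ S : Submodule k (LoopIrred φ), (∀ s ∈ S, ⁅mk (Sl2.h k) 1, s⁆ ∈ S) →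
        Disjoint S (k ∙ LoopIrred.hwv φ) → S ≤ C :=
  Loop.exists_weight_complement (φ := φ) _ (fun _ hx => LoopIrred.lie_hwv φ hx)
    fun _ hP => LoopIrred.eq_top φ hP

end HighestWeight

/-! ### Coordinates on the affine Lie algebra -/

namespace Affine

variable {k : Type*} [Field k]

/-- The inclusion of the loop algebra into the affine Lie algebra. -/
def ofLoop : Loop k →ₗ[k] Affine k :=
  (LieAlgebra.SemiDirectSum.inl (degreeAction k)).toLinearMap

variable (k) in
/-- The degree element `d` of the affine Lie algebra. -/
def d : Affine k := LieAlgebra.SemiDirectSum.inr (degreeAction k) 1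

@[simp] theorem loop_ofLoop (x : Loop k) : loop (ofLoop x) = x := rfl

@[simp] theorem deg_ofLoop (x : Loop k) : deg (ofLoop x) = 0 := rfl

@[simp] theorem loop_d : loop (d k) = 0 := rfl

@[simp] theorem deg_d : deg (d k) = 1 := rfl

theorem ext_loop_deg {x y : Affine k} (h₁ : loop x = loop y) (h₂ : deg x = deg y) : x = y :=
  LieAlgebra.SemiDirectSum.ext h₁ h₂

theorem eq_ofLoop_add (x : Affine k) : x = ofLoop (loop x) + deg x • d k := by
  refine ext_loop_deg ?_ ?_ <;> simp

end Affine

/-! ### Grading of loop modules and multiplication by powers of t -/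

namespace LoopModule

variable {k : Type*} [Field k] {M : Type*} [AddCommGroup M] [Module k M]

open LaurentPolynomial (T)

/-- The coefficient of `t ^ n`. -/
def coeff (n : ℤ) : LoopModule k M →ₗ[k] M :=
  (TensorProduct.lid k M).toLinearMap ∘ₗ
    LinearMap.rTensor M (laurentLift (Pi.single n (1 : k)))

theorem coeff_mk_T (n m : ℤ) (u : M) :
    coeff n (mk (T m : k[T;T⁻¹]) u) = if m = n then u else 0 := by
  have : coeff n (mk (T m : k[T;T⁻¹]) u) =
    (laurentLift (Pi.single n (1 : k)) (T m : k[T;T⁻¹])) • u := rfl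
  rw [this, laurentLift_T, Pi.single_apply, ite_smul, one_smul, zero_smul]

theorem mk_T_injective (n : ℤ) : Function.Injective (mk (M := M) (T n : k[T;T⁻¹])) := by
  intro u v h
  simpa [coeff_mk_T] using congrArg (coeff n) h

theorem exists_eq_sum (w : LoopModule k M) :
    ∃ f : ℤ →₀ M, f.sum (fun n u => mk (T n : k[T;T⁻¹]) u) = w := by
  classical
  induction w using LoopModule.induction with
  | h0 => exact ⟨0, Finsupp.sum_zero_index⟩
  | hmk n u => exact ⟨Finsupp.single n u, Finsupp.sum_single_index (map_zero _)⟩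
  | hadd x y hx hy =>
    obtain ⟨f, rfl⟩ := hx
    obtain ⟨g, rfl⟩ := hy
    exact ⟨f + g, Finsupp.sum_add_index' (fun _ => map_zero _) fun _ => map_add _⟩

theorem degAct_mk_T (n : ℤ) (u : M) :
    degAct (mk (T n : k[T;T⁻¹]) u) = (n : k) • mk (T n : k[T;T⁻¹]) u := by
  rw [degAct_mk, eulerOp_T, mk_smul]

/-- A graded subspace contains the components of its elements. -/
theorem mk_mem_of_sum_mem [CharZero k] {S : Submodule k (LoopModule k M)}
    (hS : ∀ w ∈ S, degAct w ∈ S) {f : ℤ →₀ M}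
    (h : f.sum (fun n u => mk (T n : k[T;T⁻¹]) u) ∈ S) (n : ℤ) :
    mk (T n : k[T;T⁻¹]) (f n) ∈ S := by
  by_cases hn : n ∈ f.support
  · exact mem_of_sum_eigenvectors_mem degAct S hS f.support (fun n : ℤ => (n : k))
      Int.cast_injective.injOn _ (fun i _ => degAct_mk_T i (f i)) h n hn
  · rw [Finsupp.notMem_support_iff.1 hn, map_zero]
    exact zero_mem _

variable [LieRingModule (Loop k) M] [LieModule k (Loop k) M]

theorem d_lie (w : LoopModule k M) : ⁅Affine.d k, w⁆ = degAct w := by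
  rw [lie_def, Affine.loop_d, Affine.deg_d, map_zero, LinearMap.zero_apply, zero_add, one_smul]

theorem ofLoop_lie (x : Loop k) (w : LoopModule k M) : ⁅Affine.ofLoop x, w⁆ = loopAct x w := by
  rw [lie_def, Affine.loop_ofLoop, Affine.deg_ofLoop, zero_smul, add_zero]

theorem ofLoop_lie_mk (x : Sl2 k) (m n : ℤ) (u : M) :
    ⁅Affine.ofLoop (Loop.mk x (T m)), mk (T n : k[T;T⁻¹]) u⁆ =
      mk (T (m + n)) ⁅Loop.mk x (T m : k[T;T⁻¹]), u⁆ := by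
  rw [ofLoop_lie, loopAct_mk, LaurentPolynomial.T_add]

/-- Linear maps that commute with the action of the generators commute with the whole algebra. -/
theorem map_lie_of_generators {W : Type*} [AddCommGroup W] [Module k W]
    [LieRingModule (Affine k) W] [LieModule k (Affine k) W] (F : LoopModule k M →ₗ[k] W)
    (hd : ∀ n u, F ⁅Affine.d k, mk (T n : k[T;T⁻¹]) u⁆ = ⁅Affine.d k, F (mk (T n : k[T;T⁻¹]) u)⁆)
    (hx : ∀ (x : Sl2 k) m n u, F ⁅Affine.ofLoop (Loop.mk x (T m)), mk (T n : k[T;T⁻¹]) u⁆ =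
      ⁅Affine.ofLoop (Loop.mk x (T m)), F (mk (T n : k[T;T⁻¹]) u)⁆)
    (x : Affine k) (w : LoopModule k M) : F ⁅x, w⁆ = ⁅x, F w⁆ := by
  induction w using LoopModule.induction with
  | h0 => simp
  | hadd v w hv hw => simp only [lie_add, map_add, hv, hw]
  | hmk n u =>
    rw [Affine.eq_ofLoop_add x, add_lie, add_lie, smul_lie, smul_lie, map_add, map_smul, hd]
    congr 1
    generalize Affine.loop x = y
    induction y using Loop.induction_T with
    | h0 => simp
    | hadd y y' h h' => simp only [map_add, add_lie, h, h']
    | hmk y m => exact hx y m n u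

/-- Multiplication by `t ^ i`. -/
def mulT (i : ℤ) : LoopModule k M →ₗ[k] LoopModule k M :=
  map LinearMap.id (LinearMap.mulLeft k (T i))

omit [LieRingModule (Loop k) M] [LieModule k (Loop k) M] in
theorem mulT_mk (i n : ℤ) (u : M) : mulT i (mk (T n : k[T;T⁻¹]) u) = mk (T (i + n)) u := by
  rw [LaurentPolynomial.T_add]; rfl

omit [LieRingModule (Loop k) M] [LieModule k (Loop k) M] in
theorem mulT_mulT (i j : ℤ) (h : i + j = 0) (w : LoopModule k M) : mulT i (mulT j w) = w := by
  induction w using LoopModule.induction with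
  | h0 => simp
  | hadd v w hv hw => simp only [map_add, hv, hw]
  | hmk n u => rw [mulT_mk, mulT_mk, ← add_assoc, h, zero_add]

/-- Multiplication by t^i commutes with the loop algebra and raises the degree by i. The extra term
is the action on k_i, which is how the one-dimensional twists enter. -/
theorem lie_mulT (i : ℤ) (x : Affine k) (w : LoopModule k M) :
    ⁅x, mulT i w⁆ = mulT i ⁅x, w⁆ + (Affine.deg x * i) • mulT i w := by
  induction w using LoopModule.induction with
  | h0 => simp
  | hadd v w hv hw => simp only [lie_add, map_add, hv, hw, smul_add]; abel
  | hmk n u =>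
    rw [Affine.eq_ofLoop_add x]
    generalize Affine.deg x = c
    simp only [add_lie, smul_lie, d_lie, degAct_mk_T, map_add, map_smul, mulT_mk, Affine.deg_ofLoop,
      Affine.deg_d, smul_eq_mul, mul_one, zero_add]
    generalize Affine.loop x = y
    have hy : ⁅Affine.ofLoop y, mk (T (i + n) : k[T;T⁻¹]) u⁆ =
        mulT i ⁅Affine.ofLoop y, mk (T n : k[T;T⁻¹]) u⁆ := by
      induction y using Loop.induction_T with
      | h0 => simp
      | hadd y y' h h' => simp only [map_add, add_lie, h, h']
      | hmk y m => rw [ofLoop_lie_mk, ofLoop_lie_mk, mulT_mk, add_left_comm]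
    rw [hy, add_assoc, smul_smul, smul_smul, ← add_smul, ← mul_add, Int.cast_add, add_comm (i : k)]

end LoopModule

/-! ### The automorphism η̂ and the vectors v ⊗ t^n -/

section EtaHat

variable {k : Type*} [Field k] (φ : ℤ → k) (ζ : kˣ) (hζ : ∀ m, φ m ≠ 0 → ζ ^ m = 1)

open LoopModule Loop
open LaurentPolynomial (T)

theorem etaHat_mk_T (n : ℤ) (u : LoopIrred φ) : etaHat φ ζ hζ (mk (T n) u) =
    ((ζ ^ n : kˣ) : k) • mk (T n) (eta φ ζ hζ u) := by
  rw [etaHat_mk, scaleHom_T, LoopModule.mk_smul]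

/-- For x ⊗ t^m, the scalar ζ^(-m) produced by η cancels the scalar ζ^m produced by t ↦ ζt. For d,
rescaling t preserves degrees. -/
theorem etaHat_lie (x : Affine k) (w : LoopModule k (LoopIrred φ)) :
    etaHat φ ζ hζ ⁅x, w⁆ = ⁅x, etaHat φ ζ hζ w⁆ := by
  refine map_lie_of_generators (etaHat φ ζ hζ) (fun n u => ?_) (fun x m n u => ?_) x w
  · simp only [d_lie, degAct_mk_T, map_smul, etaHat_mk_T]
    rw [smul_comm]
  · rw [ofLoop_lie_mk, etaHat_mk_T, etaHat_mk_T, eta_lie, scaleHom_T, Loop.mk_smul, smul_lie,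
      map_smul, smul_smul, lie_smul, ofLoop_lie_mk, ← Units.val_mul, inv_zpow', ← zpow_add]
    congr 4
    ring

/-- The eigenspace of `etaHat` with eigenvalue `ζ ^ i`, as a submodule. -/
def etaEigen (i : ℤ) : LieSubmodule k (Affine k) (LoopModule k (LoopIrred φ)) :=
  { (etaHat φ ζ hζ).eigenspace ((ζ ^ i : kˣ) : k) with
    lie_mem := by
      intro x w hw
      have hw : w ∈ (etaHat φ ζ hζ).eigenspace ((ζ ^ i : kˣ) : k) := hw
      change ⁅x, w⁆ ∈ (etaHat φ ζ hζ).eigenspace ((ζ ^ i : kˣ) : k)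
      rw [Module.End.mem_eigenspace_iff] at hw ⊢
      rw [etaHat_lie, hw, lie_smul] }

theorem mem_etaEigen {i : ℤ} {w : LoopModule k (LoopIrred φ)} :
    w ∈ etaEigen φ ζ hζ i ↔ etaHat φ ζ hζ w = ((ζ ^ i : kˣ) : k) • w :=
  Module.End.mem_eigenspace_iff

/-- The vector `v ⊗ t ^ n`, where `v` is the highest weight vector. -/
def hwvT (n : ℤ) : LoopModule k (LoopIrred φ) := mk (T n) (LoopIrred.hwv φ)

theorem etaHat_hwvT (n : ℤ) : etaHat φ ζ hζ (hwvT φ n) = ((ζ ^ n : kˣ) : k) • hwvT φ n := by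
  rw [hwvT, etaHat_mk_T, eta_hwv]

theorem hwvT_mem_etaEigen (n : ℤ) : hwvT φ n ∈ etaEigen φ ζ hζ n :=
  (mem_etaEigen φ ζ hζ).2 (etaHat_hwvT φ ζ hζ n)

/-- The vectors u with u ⊗ t^n in P for every n form a loop submodule of L(φ). It contains the
generator v, so it is everything. -/
theorem eq_top_of_hwvT_mem (P : LieSubmodule k (Affine k) (LoopModule k (LoopIrred φ)))
    (h : ∀ n, hwvT φ n ∈ P) : P = ⊤ := by
  let K : LieSubmodule k (Loop k) (LoopIrred φ) :=
    { (⨅ n : ℤ, P.toSubmodule.comap (mk (T n)) : Submodule k (LoopIrred φ)) with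
      lie_mem := by
        intro x u hu
        change u ∈ ⨅ n : ℤ, P.toSubmodule.comap (mk (T n)) at hu
        change ⁅x, u⁆ ∈ ⨅ n : ℤ, P.toSubmodule.comap (mk (T n))
        rw [Submodule.mem_iInf] at hu ⊢
        intro n
        induction x using Loop.induction_T with
        | h0 => rw [zero_lie]; exact zero_mem _
        | hadd x y hx hy => rw [add_lie]; exact add_mem hx hy
        | hmk x m =>
          -- To reach degree n with x ⊗ t^m, start from u ⊗ t^(n-m); this is why all degrees are
          -- required at once.
          have h1 := P.lie_mem (x := Affine.ofLoop (Loop.mk x (T m))) (hu (n - m))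
          rw [ofLoop_lie_mk, add_sub_cancel] at h1
          exact h1 }
  have hK : K = ⊤ := LoopIrred.eq_top φ ((Submodule.mem_iInf _).2 h)
  refine top_le_iff.1 fun w _ => ?_
  induction w using LoopModule.induction with
  | h0 => exact zero_mem _
  | hadd v w hv hw => exact add_mem (hv trivial) (hw trivial)
  | hmk n u =>
    have hu : u ∈ K := hK ▸ LieSubmodule.mem_top u
    exact (Submodule.mem_iInf _).1 hu n

theorem ofLoop_h_lie_hwvT (m n : ℤ) :
    ⁅Affine.ofLoop (Loop.mk (Sl2.h k) (T m)), hwvT φ n⁆ = φ m • hwvT φ (m + n) := by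
  rw [hwvT, ofLoop_lie_mk, LoopIrred.lie_hwv φ (diag_le_borel (h_mem_diag _)),
    (entry_mk_h (k := k) _).1, evalAt, laurentLift_T, map_smul, hwvT]

/-- For m in the support, h ⊗ t^m moves v ⊗ t^n to a non-zero multiple of v ⊗ t^(m+n). Iterating
reaches exactly the shifts in the monoid generated by the support. -/
theorem hwvT_add_mem {P : LieSubmodule k (Affine k) (LoopModule k (LoopIrred φ))} {m : ℤ}
    (hm : m ∈ AddSubmonoid.closure (Function.support φ)) (n : ℤ) (hn : hwvT φ n ∈ P) :
    hwvT φ (n + m) ∈ P := by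
  induction hm using AddSubmonoid.closure_induction generalizing n with
  | zero => rwa [add_zero]
  | mem m hm =>
    have h1 := P.lie_mem (x := Affine.ofLoop (Loop.mk (Sl2.h k) (T m))) hn
    rw [ofLoop_h_lie_hwvT, add_comm] at h1
    exact (P.toSubmodule.smul_mem_iff hm).1 h1
  | add a b _ _ ha hb => rw [← add_assoc]; exact hb _ (ha _ hn)

variable [CharZero k]

theorem hwvT_ne_zero (n : ℤ) : hwvT φ n ≠ 0 := by
  intro h
  exact LoopIrred.hwv_ne_zero φ (mk_T_injective n (h.trans (map_zero _).symm))

/-- Every non-zero submodule of the loop module contains a highest weight vector `v ⊗ t ^ n`. -/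
theorem exists_hwvT_mem (P : LieSubmodule k (Affine k) (LoopModule k (LoopIrred φ)))
    (hP : P ≠ ⊥) : ∃ n, hwvT φ n ∈ P := by
  -- The sum of the homogeneous slices {u : u ⊗ t^n ∈ P}. The element x ⊗ t^m maps slice n to slice
  -- m + n, so only the sum is a submodule.
  let K : LieSubmodule k (Loop k) (LoopIrred φ) :=
    { (⨆ n : ℤ, P.toSubmodule.comap (mk (T n)) : Submodule k (LoopIrred φ)) with
      lie_mem := by
        intro x u hu
        change u ∈ ⨆ n : ℤ, P.toSubmodule.comap (mk (T n)) at hu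
        change ⁅x, u⁆ ∈ ⨆ n : ℤ, P.toSubmodule.comap (mk (T n))
        induction hu using Submodule.iSup_induction' with
        | zero => rw [lie_zero]; exact zero_mem _
        | add a b _ _ ha hb => rw [lie_add]; exact add_mem ha hb
        | mem n u hu =>
          induction x using Loop.induction_T with
          | h0 => rw [zero_lie]; exact zero_mem _
          | hadd x y hx hy => rw [add_lie]; exact add_mem hx hy
          | hmk x m =>
            have h1 := P.lie_mem (x := Affine.ofLoop (Loop.mk x (T m))) hu
            rw [ofLoop_lie_mk] at h1
            exact le_iSup (fun n : ℤ => P.toSubmodule.comap (mk (M := LoopIrred φ) (T n)))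
              (m + n) h1 }
  have hKbot : K ≠ ⊥ := by
    intro hK
    refine hP (le_bot_iff.1 fun w hw => ?_)
    obtain ⟨f, rfl⟩ := exists_eq_sum w
    have hf : f = 0 := by
      ext n
      have h1 : f n ∈ K := le_iSup (fun n : ℤ => P.toSubmodule.comap (mk (M := LoopIrred φ) (T n)))
        n (mk_mem_of_sum_mem (S := P.toSubmodule)
          (fun w hw => by rw [← d_lie]; exact P.lie_mem hw) hw n)
      rw [hK] at h1
      simpa using h1
    rw [hf, Finsupp.sum_zero_index]
    exact zero_mem _
  have := LoopIrred.isIrreducible φ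
  have hKtop : K = ⊤ := (IsSimpleOrder.eq_bot_or_eq_top K).resolve_left hKbot
  obtain ⟨C, hdisj, hC⟩ := LoopIrred.exists_weight_complement φ
  by_contra! hno
  -- Each slice is stable under h ⊗ 1, which has degree zero. If it contains no multiple of v but
  -- zero, it lies in the complement C of the line through v, while the sum of the slices contains
  -- v.
  have hle : (⨆ n : ℤ, P.toSubmodule.comap (mk (T n)) : Submodule k (LoopIrred φ)) ≤ C := by
    refine iSup_le fun n => hC _ (fun u hu => ?_) (Submodule.disjoint_def.2 fun u hu hu' => ?_)
    · have h1 := P.lie_mem (x := Affine.ofLoop (Loop.mk (Sl2.h k) (T 0))) hu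
      rw [ofLoop_lie_mk, zero_add, LaurentPolynomial.T_zero] at h1
      exact h1
    · obtain ⟨c, rfl⟩ := Submodule.mem_span_singleton.1 hu'
      by_contra hne
      have hc : c ≠ 0 := fun h => hne (by rw [h, zero_smul])
      exact hno n ((P.toSubmodule.smul_mem_iff hc).1 (by simpa [hwvT] using hu))
  have hv : LoopIrred.hwv φ ∈ K := hKtop ▸ LieSubmodule.mem_top _
  exact LoopIrred.hwv_ne_zero φ
    (Submodule.disjoint_def.1 hdisj _ (Submodule.mem_span_singleton_self _) (hle hv))

end EtaHat

open LaurentPolynomial (T)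

/-! ### Irreducibility of the eigenspaces of η̂ -/

section Irreducible

variable {k : Type*} [Field k] [CharZero k] {φ : ℤ → k} {ζ : kˣ}
  (hζ : ∀ m, φ m ≠ 0 → ζ ^ m = 1)

open LoopModule

omit [CharZero k] in
theorem zpow_val_injective {r : ℕ} [NeZero r] (hr : IsPrimitiveRoot ζ r) :
    Function.Injective fun j : ZMod r => ((ζ ^ j.val : kˣ) : k) := fun a b hab =>
  ZMod.val_injective _ (hr.pow_inj (ZMod.val_lt a) (ZMod.val_lt b) (Units.ext hab))

omit [CharZero k] in
/-- The vectors `v ⊗ t ^ j`, for `j` in a system of residues modulo `r`, generate the loop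
module. -/
theorem iSup_lieSpan_hwvT {r : ℕ} [NeZero r] (hr : IsPrimitiveRoot ζ r)
    (hmon : ∀ n : ℤ, ζ ^ n = 1 → n ∈ AddSubmonoid.closure (Function.support φ)) :
    ⨆ j : ZMod r, LieSubmodule.lieSpan k (Affine k) {hwvT φ j.val} = ⊤ := by
  refine eq_top_of_hwvT_mem φ _ fun n => ?_
  have h1 : hwvT φ (n : ZMod r).val ∈
      ⨆ j : ZMod r, LieSubmodule.lieSpan k (Affine k) {hwvT φ j.val} :=
    LieSubmodule.mem_iSup_of_mem (n : ZMod r) (LieSubmodule.subset_lieSpan rfl)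
  -- The integer n differs from its residue by a multiple of r, and such multiples lie in the monoid
  -- generated by the support.
  have h2 := hwvT_add_mem φ (m := n - (n : ZMod r).val) (hmon _ ?_) _ h1
  · rwa [add_sub_cancel] at h2
  · rw [hr.zpow_eq_one_iff_dvd, ← ZMod.intCast_zmod_eq_zero_iff_dvd]
    simp

omit [CharZero k] in
theorem lieSpan_hwvT_le (n : ℤ) :
    LieSubmodule.lieSpan k (Affine k) {hwvT φ n} ≤ etaEigen φ ζ hζ n :=
  LieSubmodule.lieSpan_le.2 (Set.singleton_subset_iff.2 (hwvT_mem_etaEigen φ ζ hζ n))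

omit [CharZero k] in
theorem iSup_etaEigen {r : ℕ} [NeZero r] (hr : IsPrimitiveRoot ζ r)
    (hmon : ∀ n : ℤ, ζ ^ n = 1 → n ∈ AddSubmonoid.closure (Function.support φ)) :
    ⨆ j : ZMod r, etaEigen φ ζ hζ j.val = ⊤ := by
  rw [← top_le_iff, ← iSup_lieSpan_hwvT hr hmon]
  exact iSup_mono fun j => lieSpan_hwvT_le hζ _

omit [CharZero k] in
/-- The eigenspace of `etaHat` is generated by each of its vectors `v ⊗ t ^ i`. -/
theorem etaEigen_le_of_hwvT_mem {r : ℕ} [NeZero r] (hr : IsPrimitiveRoot ζ r)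
    (hmon : ∀ n : ℤ, ζ ^ n = 1 → n ∈ AddSubmonoid.closure (Function.support φ)) {i : ℤ}
    {P : LieSubmodule k (Affine k) (LoopModule k (LoopIrred φ))} (hP : hwvT φ i ∈ P) :
    etaEigen φ ζ hζ i ≤ P := by
  intro w hw
  have hw' : w ∈ (⨆ j : ZMod r, LieSubmodule.lieSpan k (Affine k) {hwvT φ j.val}).toSubmodule := by
    rw [iSup_lieSpan_hwvT hr hmon]
    trivial
  rw [LieSubmodule.iSup_toSubmodule] at hw'
  obtain ⟨f, hf, rfl⟩ := (Submodule.mem_iSup_iff_exists_finsupp _ _).1 hw'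
  have hfe : ∀ j, etaHat φ ζ hζ (f j) = ((ζ ^ j.val : kˣ) : k) • f j := fun j => by
    have := (mem_etaEigen φ ζ hζ).1 (lieSpan_hwvT_le hζ _ (hf j))
    rwa [zpow_natCast] at this
  refine sum_mem fun j hj => ?_
  -- Write w as a sum of f j in the submodules generated by v ⊗ t^j. The eigenspace for ζ^i is
  -- stable, so it contains each f j. Either f j vanishes, or ζ^j = ζ^i and v ⊗ t^j already lies in
  -- P.
  have h1 := mem_of_sum_eigenvectors_mem (etaHat φ ζ hζ) (etaEigen φ ζ hζ i).toSubmodule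
    (fun x hx => by
      rw [(mem_etaEigen φ ζ hζ).1 hx]
      exact Submodule.smul_mem _ _ hx) f.support _ (zpow_val_injective hr).injOn f
    (fun j _ => hfe j) hw j hj
  by_cases hij : ζ ^ i = ζ ^ j.val
  · have h2 : hwvT φ j.val ∈ P := by
      have h3 := hwvT_add_mem φ (m := j.val - i) (hmon _ (by
        rw [zpow_sub, hij, zpow_natCast, mul_inv_cancel])) i hP
      rwa [add_sub_cancel] at h3
    exact LieSubmodule.lieSpan_le.2 (Set.singleton_subset_iff.2 h2) (hf j)
  · have h2 : etaHat φ ζ hζ (f j) = ((ζ ^ i : kˣ) : k) • f j := (mem_etaEigen φ ζ hζ).1 h1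
    rw [hfe j, ← sub_eq_zero, ← sub_smul, smul_eq_zero, sub_eq_zero] at h2
    rw [h2.resolve_left fun h => hij (Units.ext h).symm]
    exact zero_mem _

/-- A non-zero submodule contains some v ⊗ t^n. Its eigenvalue forces n ≡ i modulo r, so the
submodule also contains v ⊗ t^i, which generates the eigenspace. -/
theorem etaEigen_isIrreducible {r : ℕ} [NeZero r] (hr : IsPrimitiveRoot ζ r)
    (hmon : ∀ n : ℤ, ζ ^ n = 1 → n ∈ AddSubmonoid.closure (Function.support φ)) (i : ℤ) :
    LieModule.IsIrreducible k (Affine k) (etaEigen φ ζ hζ i) := by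
  have hnt : Nontrivial (etaEigen φ ζ hζ i) :=
    ⟨⟨⟨_, hwvT_mem_etaEigen φ ζ hζ i⟩, 0, fun h => hwvT_ne_zero φ i (congrArg Subtype.val h)⟩⟩
  refine LieModule.IsIrreducible.mk fun P hP => ?_
  set P' := P.map (etaEigen φ ζ hζ i).incl with hP'
  have hmem : ∀ w, w ∈ P' ↔ ∃ h : w ∈ etaEigen φ ζ hζ i, ⟨w, h⟩ ∈ P := by
    intro w
    rw [hP', LieSubmodule.mem_map]
    constructor
    · rintro ⟨y, hy, rfl⟩
      exact ⟨y.2, hy⟩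
    · rintro ⟨h, hw⟩
      exact ⟨_, hw, rfl⟩
  have hbot : P' ≠ ⊥ := by
    intro h
    refine hP (le_bot_iff.1 fun w hw => ?_)
    have h1 : (w : LoopModule k (LoopIrred φ)) ∈ P' := (hmem _).2 ⟨w.2, hw⟩
    rw [h, LieSubmodule.mem_bot] at h1
    exact (LieSubmodule.mem_bot _).2 (Subtype.ext h1)
  obtain ⟨n, hn⟩ := exists_hwvT_mem φ P' hbot
  have hni : ζ ^ n = ζ ^ i := by
    obtain ⟨h, -⟩ := (hmem _).1 hn
    have h1 := (mem_etaEigen φ ζ hζ).1 h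
    rw [etaHat_hwvT, ← sub_eq_zero, ← sub_smul, smul_eq_zero, sub_eq_zero] at h1
    exact Units.ext (h1.resolve_right (hwvT_ne_zero φ n))
  have hi : hwvT φ i ∈ P' := by
    have h3 := hwvT_add_mem φ (m := i - n) (hmon _ (by
      rw [zpow_sub, hni, mul_inv_cancel])) n hn
    rwa [add_sub_cancel] at h3
  refine top_le_iff.1 fun w _ => ?_
  exact ((hmem _).1 (etaEigen_le_of_hwvT_mem hζ hr hmon hi w.2)).2

end Irreducible

/-! ### The module H(φ), its induced module, and the identification with L̃(φ) -/

section AffineInduced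

variable {k : Type*} [Field k] {φ : ℤ → k} {ζ : kˣ}

open Loop

theorem scaleHom_hadamard (hζ : ∀ m, φ m ≠ 0 → ζ ^ m = 1) (a : k[T;T⁻¹]) :
    scaleHom ζ (hadamard φ a) = hadamard φ a := by
  induction a using laurent_induction with
  | hadd a b ha hb => rw [map_add, map_add, ha, hb]
  | hsmul c a ha => rw [map_smul, map_smul, ha]
  | hT n =>
    rw [hadamard, laurentLift_T, map_smul, scaleHom_T]
    by_cases h : φ n = 0
    · rw [h, zero_smul, zero_smul]
    · rw [hζ n h, Units.val_one, one_smul]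

theorem scaleHom_eulerOp (a : k[T;T⁻¹]) : scaleHom ζ (eulerOp a) = eulerOp (scaleHom ζ a) := by
  induction a using laurent_induction with
  | hadd a b ha hb => simp only [map_add, ha, hb]
  | hsmul c a ha => simp only [map_smul, ha]
  | hT n => rw [eulerOp_T, map_smul, scaleHom_T, map_smul, eulerOp_T, smul_comm]

/-- The Laurent polynomials invariant under t ↦ ζt contain 1 and form a submodule: h ⊗ t^m acts
non-trivially only when ζ^m = 1, and d commutes with rescaling. -/
theorem scaleHom_eq_of_mem_hMod (hζ : ∀ m, φ m ≠ 0 → ζ ^ m = 1) {p : k[T;T⁻¹]}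
    (hp : (p : LaurentModule φ) ∈ hMod φ) : scaleHom ζ p = p := by
  let K : LieSubmodule k (affineBorel k) (LaurentModule φ) :=
    { (LinearMap.eqLocus (scaleHom ζ) LinearMap.id : Submodule k k[T;T⁻¹]) with
      lie_mem := by
        intro x q hq
        have key : ∀ p : k[T;T⁻¹], scaleHom ζ p = p →
            scaleHom ζ (laurentAct φ x p) = laurentAct φ x p := fun p hp => by
          rw [laurentAct_apply, map_add, scaleHom_mul, scaleHom_hadamard hζ, map_smul,
            scaleHom_eulerOp, hp]
        exact key q hq }
  have h1 : (1 : k[T;T⁻¹]) ∈ (LinearMap.eqLocus (scaleHom ζ) LinearMap.id :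
      Submodule k k[T;T⁻¹]) := by
    change scaleHom ζ 1 = (1 : k[T;T⁻¹])
    rw [← LaurentPolynomial.T_zero, scaleHom_T, zpow_zero, Units.val_one, one_smul]
  have hle : hMod φ ≤ K := LieSubmodule.lieSpan_le.2 (Set.singleton_subset_iff.2 h1)
  exact hle hp

theorem ofLoop_mem_affineBorel {x : Loop k} (hx : x ∈ borel k) :
    Affine.ofLoop x ∈ affineBorel k := hx

theorem d_mem_affineBorel : Affine.d k ∈ affineBorel k := map_zero (entry 1 0)

theorem laurentAct_h (m : ℤ) (p : k[T;T⁻¹]) :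
    laurentAct φ (Affine.ofLoop (Loop.mk (Sl2.h k) (T m))) p = φ m • (T m * p) := by
  rw [laurentAct_apply, Affine.loop_ofLoop, Affine.deg_ofLoop, zero_smul, add_zero,
    (entry_mk_h (k := k) _).1, hadamard, laurentLift_T, smul_mul_assoc]

theorem laurentAct_d (p : k[T;T⁻¹]) : laurentAct φ (Affine.d k) p = eulerOp p := by
  rw [laurentAct_apply, Affine.loop_d, Affine.deg_d, map_zero, map_zero, zero_mul, zero_add,
    one_smul]

/-- The module `H(φ)` is irreducible. -/
theorem hMod_le_of_mem [CharZero k] (hζ : ∀ m, φ m ≠ 0 → ζ ^ m = 1)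
    (hmon : ∀ n : ℤ, ζ ^ n = 1 → n ∈ AddSubmonoid.closure (Function.support φ))
    (Y : LieSubmodule k (affineBorel k) (LaurentModule φ)) (hY : Y ≤ hMod φ)
    {q : LaurentModule φ} (hq : q ∈ Y) (hq0 : q ≠ 0) : hMod φ ≤ Y := by
  have hact : ∀ x ∈ affineBorel k, ∀ p : k[T;T⁻¹], (p : LaurentModule φ) ∈ Y →
      (laurentAct φ x p : LaurentModule φ) ∈ Y := fun x hx p hp => Y.lie_mem (x := ⟨x, hx⟩) hp
  let Y' : Submodule k k[T;T⁻¹] := Y.toSubmodule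
  -- The operator d acts on t^n by n, so Y contains every monomial that occurs in q.
  obtain ⟨n, hn⟩ : ∃ n : ℤ, (T n : k[T;T⁻¹]) ∈ Y' := by
    have hsum := (AddMonoidAlgebra.basis ℤ k).linearCombination_repr q
    rw [Finsupp.linearCombination_apply, Finsupp.sum] at hsum
    set f := (AddMonoidAlgebra.basis ℤ k).repr q with hf
    have hf0 : f ≠ 0 := fun h =>
      hq0 ((AddMonoidAlgebra.basis ℤ k).repr.map_eq_zero_iff.1 h)
    obtain ⟨n, hn⟩ := Finsupp.support_nonempty_iff.2 hf0
    have hT : ∀ n, AddMonoidAlgebra.basis ℤ k n = (T n : k[T;T⁻¹]) := fun n => by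
      rw [AddMonoidAlgebra.basis_apply]; rfl
    simp only [hT] at hsum
    have := mem_of_sum_eigenvectors_mem eulerOp Y' (fun p hp => by
      rw [← laurentAct_d (φ := φ)]
      exact hact _ d_mem_affineBorel p hp) f.support (fun n : ℤ => (n : k))
      Int.cast_injective.injOn (fun n => f n • (T n : k[T;T⁻¹]))
      (fun n _ => by rw [map_smul, eulerOp_T, smul_comm]) (by rw [hsum]; exact hq) n hn
    exact ⟨n, (Y'.smul_mem_iff (Finsupp.mem_support_iff.1 hn)).1 this⟩
  have hadd : ∀ m ∈ AddSubmonoid.closure (Function.support φ), ∀ n : ℤ,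
      (T n : k[T;T⁻¹]) ∈ Y' → (T (n + m) : k[T;T⁻¹]) ∈ Y' := by
    intro m hm
    induction hm using AddSubmonoid.closure_induction with
    | zero => intro n hn; rwa [add_zero]
    | mem m hm =>
      intro n hn
      have h1 := hact _ (ofLoop_mem_affineBorel (diag_le_borel (h_mem_diag (T m)))) _ hn
      rw [laurentAct_h, ← LaurentPolynomial.T_add, add_comm] at h1
      exact (Y'.smul_mem_iff hm).1 h1
    | add a b _ _ ha hb => intro n hn; rw [← add_assoc]; exact hb _ (ha _ hn)
  have hζn : ζ ^ n = 1 := by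
    have h1 := scaleHom_eq_of_mem_hMod hζ (hY hn)
    rw [scaleHom_T, ← sub_eq_zero] at h1
    nth_rw 2 [← one_smul k (T n : k[T;T⁻¹])] at h1
    rw [← sub_smul, smul_eq_zero, sub_eq_zero] at h1
    exact Units.ext (h1.resolve_right (LaurentPolynomial.isUnit_T n).ne_zero)
  -- Invariance of t^n gives ζ^n = 1, so -n lies in the monoid as well and t^n can be moved back to
  -- the generator 1.
  have h1 := hadd (-n) (hmon _ (by rw [zpow_neg, hζn, inv_one])) n hn
  rw [add_neg_cancel, LaurentPolynomial.T_zero] at h1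
  exact LieSubmodule.lieSpan_le.2 (Set.singleton_subset_iff.2 h1)

/-- The space of highest-weight vectors is now the image of H(φ), on which h ⊗ 1 still acts by the
single scalar φ(0). The element d is counted in the middle part of the triangular decomposition,
which therefore carries no condition on `deg`. -/
theorem affineInd_exists_weight_complement [CharZero k] (φ : ℤ → k) :
    ∃ C : Submodule k (Ind (affineBorel k) (hMod φ)),
      Disjoint (LinearMap.range (Ind.of (affineBorel k) (hMod φ))) C ∧
      ∀ S : Submodule k (Ind (affineBorel k) (hMod φ)),
        (∀ s ∈ S, ⁅Affine.ofLoop (Loop.mk (Sl2.h k) 1), s⁆ ∈ S) →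
        Disjoint S (LinearMap.range (Ind.of (affineBorel k) (hMod φ))) → S ≤ C := by
  have hof : ∀ (x : Affine k) (hx : x ∈ affineBorel k) (n : hMod φ),
      ⁅x, Ind.of (affineBorel k) (hMod φ) n⁆ =
        Ind.of (affineBorel k) (hMod φ) ⁅(⟨x, hx⟩ : affineBorel k), n⁆ :=
    fun x hx n => (Ind.of_lie _ _ ⟨x, hx⟩ n).symm
  refine exists_weight_complement
    ((lower k).comap Affine.loop ⊓ LinearMap.ker Affine.deg)
    ((diag k).comap Affine.loop) ((upper k).comap Affine.loop ⊓ LinearMap.ker Affine.deg)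
    ?_ ?_ ?_ _ ?_ _ ?_ ?_ (φ 0) ?_ ?_
  · refine top_le_iff.1 fun x _ => ?_
    obtain ⟨a, ha, b, hb, c, hc, habc⟩ := exists_triangular (Affine.loop x)
    have hx : x = Affine.ofLoop a + (Affine.ofLoop b + Affine.deg x • Affine.d k) +
        Affine.ofLoop c := by
      refine Affine.ext_loop_deg ?_ ?_ <;> simp [habc]
    rw [hx]
    refine Submodule.add_mem_sup (Submodule.add_mem_sup ⟨ha, Affine.deg_ofLoop a⟩ ?_)
      ⟨hc, Affine.deg_ofLoop c⟩
    simpa using hb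
  · rintro x hx y ⟨hy, hy0⟩
    refine ⟨?_, Affine.deg_lie x y⟩
    have hy0 : Affine.deg y = 0 := hy0
    change Affine.loop ⁅x, y⁆ ∈ lower k
    rw [Affine.loop_lie, hy0, zero_smul, sub_zero]
    refine add_mem (diag_lie_lower hx hy) (Submodule.smul_mem _ _ ?_)
    have hy := mem_lower.1 hy
    rw [mem_lower, entry_degreeDer, entry_degreeDer, hy.1, hy.2, map_zero]
    exact ⟨rfl, rfl⟩
  · rintro x ⟨hx, hx0⟩ y ⟨hy, hy0⟩
    have hy0 : Affine.deg y = 0 := hy0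
    have hx0 : Affine.deg x = 0 := hx0
    change Affine.loop ⁅x, y⁆ ∈ diag k
    rw [Affine.loop_lie, hy0, hx0, zero_smul, zero_smul, sub_zero, add_zero]
    exact upper_lie_lower hx hy
  · rintro y ⟨hy, hy0⟩
    have hy0 : Affine.deg y = 0 := hy0
    refine Affine.ext_loop_deg ?_ ?_
    · rw [Affine.loop_lie, hy0, Affine.deg_ofLoop, Affine.loop_ofLoop, zero_smul, zero_smul,
        sub_zero, add_zero, map_smul]
      exact h_lie_lower hy
    · rw [Affine.deg_lie, map_smul, hy0, smul_zero]
  · rintro x hx _ ⟨n, rfl⟩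
    rw [hof x (diag_le_borel hx)]
    exact ⟨_, rfl⟩
  · rintro x ⟨hx, hx0⟩ _ ⟨n, rfl⟩
    have hx0 : Affine.deg x = 0 := hx0
    rw [hof x (upper_le_borel hx)]
    refine (congrArg _ (Subtype.ext ?_)).trans (map_zero _)
    have key : ∀ p : k[T;T⁻¹], laurentAct φ x p = 0 := fun p => by
      rw [laurentAct_apply, (mem_upper.1 hx).1, hx0, map_zero, zero_smul, add_zero, zero_mul]
    exact key _
  · rintro _ ⟨n, rfl⟩
    rw [hof _ (ofLoop_mem_affineBorel (diag_le_borel (h_mem_diag 1))), ← map_smul]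
    refine congrArg _ (Subtype.ext ?_)
    have key : ∀ p : k[T;T⁻¹],
        laurentAct φ (Affine.ofLoop (Loop.mk (Sl2.h k) 1)) p = φ 0 • p := fun p => by
      rw [← LaurentPolynomial.T_zero, laurentAct_h, LaurentPolynomial.T_zero, one_mul]
    exact key _
  · exact fun P hP => Ind.eq_top_of_of_mem _ _ P fun n => hP ⟨n, rfl⟩

/-- The submodule of `H(φ)` that is mapped to the submodule `P` of the induced module. -/
def hModComap (P : LieSubmodule k (Affine k) (Ind (affineBorel k) (hMod φ))) :
    LieSubmodule k (affineBorel k) (LaurentModule φ) :=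
  { ((P.toSubmodule.comap (Ind.of (affineBorel k) (hMod φ))).map (hMod φ).toSubmodule.subtype) with
    lie_mem := by
      rintro x _ ⟨n, hn, rfl⟩
      let n' : hMod φ := n
      refine ⟨(⁅x, n'⁆ : hMod φ), ?_, rfl⟩
      change Ind.of (affineBorel k) (hMod φ) ⁅x, n'⁆ ∈ P
      rw [Ind.of_lie]
      exact P.lie_mem hn }

theorem mem_hModComap {P : LieSubmodule k (Affine k) (Ind (affineBorel k) (hMod φ))}
    {n : hMod φ} : (n : LaurentModule φ) ∈ hModComap P ↔
      Ind.of (affineBorel k) (hMod φ) n ∈ P := by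
  constructor
  · rintro ⟨n', hn', he⟩
    rwa [← Subtype.ext (a1 := n') (a2 := n) he]
  · exact fun h => ⟨n, h, rfl⟩

/-- The vectors of H(φ) whose image lies in P form a submodule of the irreducible module H(φ), so P
contains all of the image or meets it only in zero. Nonvanishing of that image is assumed here; it
comes from the map to the loop module. -/
theorem affineInd_properSum_ne_top [CharZero k] (hζ : ∀ m, φ m ≠ 0 → ζ ^ m = 1)
    (hmon : ∀ n : ℤ, ζ ^ n = 1 → n ∈ AddSubmonoid.closure (Function.support φ))
    (hne : Ind.of (affineBorel k) (hMod φ) ≠ 0) :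
    properSum k (Affine k) (Ind (affineBorel k) (hMod φ)) ≠ ⊤ := by
  refine properSum_ne_top (by rwa [Ne, LinearMap.range_eq_bot])
    (affineInd_exists_weight_complement φ) ?_
  rintro P _ ⟨n, rfl⟩ hnP hn0
  have hle : hMod φ ≤ hModComap P := by
    refine hMod_le_of_mem hζ hmon _ ?_ (mem_hModComap.2 hnP) fun h => hn0 ?_
    · rintro _ ⟨n', -, rfl⟩
      exact n'.2
    · rw [show n = 0 from Subtype.ext h, map_zero]
  exact Ind.eq_top_of_of_mem _ _ P fun n' => mem_hModComap.1 (hle n'.2)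

/-- On v ⊗ a the upper triangular part acts only through a, by the rule that defines H(φ). Hence p ↦
v ⊗ p is equivariant. -/
theorem loopAct_mk_hwv {x : Loop k} (hx : x ∈ borel k) (a : k[T;T⁻¹]) :
    LoopModule.loopAct x (LoopModule.mk a (LoopIrred.hwv φ)) =
      LoopModule.mk (hadamard φ (entry 0 0 x) * a) (LoopIrred.hwv φ) := by
  rw [Loop.eq_basis x, mem_borel.1 hx]
  generalize entry 0 1 x = α
  generalize entry 0 0 x = β
  have h0 : Loop.mk (Sl2.f k) 0 = 0 := TensorProduct.zero_tmul _ _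
  have hα : LoopModule.loopAct (Loop.mk (Sl2.e k) α) (LoopModule.mk a (LoopIrred.hwv φ)) = 0 := by
    induction α using laurent_induction with
    | hadd α β hα hβ => rw [Loop.mk_add, map_add, LinearMap.add_apply, hα, hβ, add_zero]
    | hsmul c α hα => rw [Loop.mk_smul, map_smul, LinearMap.smul_apply, hα, smul_zero]
    | hT n =>
      rw [LoopModule.loopAct_mk, LoopIrred.lie_hwv φ (entry_mk_e (k := k) _).2.2,
        (entry_mk_e (k := k) _).1, map_zero, zero_smul, map_zero]
  have hβ : LoopModule.loopAct (Loop.mk (Sl2.h k) β) (LoopModule.mk a (LoopIrred.hwv φ)) =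
      LoopModule.mk (hadamard φ β * a) (LoopIrred.hwv φ) := by
    induction β using laurent_induction with
    | hadd α β hα hβ =>
      rw [Loop.mk_add, map_add, LinearMap.add_apply, hα, hβ, map_add, add_mul, LoopModule.mk_add]
    | hsmul c α hα =>
      rw [Loop.mk_smul, map_smul, LinearMap.smul_apply, hα, map_smul, smul_mul_assoc,
        LoopModule.mk_smul]
    | hT n =>
      rw [LoopModule.loopAct_mk, LoopIrred.lie_hwv φ (entry_mk_h (k := k) _).2.2,
        (entry_mk_h (k := k) _).1, evalAt, laurentLift_T, hadamard, laurentLift_T, map_smul,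
        smul_mul_assoc, LoopModule.mk_smul]
  rw [h0, add_zero, map_add, LinearMap.add_apply, hα, hβ, zero_add, map_add, map_add,
    (entry_mk_e (k := k) _).1, (entry_mk_h (k := k) _).1, map_zero, zero_add]

/-- The homomorphism from the induced module to the loop module of `L(φ)` that maps `p ∈ H(φ)` to
`v ⊗ p`. -/
theorem affineInd_exists_hom (φ : ℤ → k) :
    ∃ g : Ind (affineBorel k) (hMod φ) →ₗ⁅k,Affine k⁆ LoopModule k (LoopIrred φ),
      ∀ n : hMod φ, g (Ind.of (affineBorel k) (hMod φ) n) =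
        LoopModule.mk (n : LaurentModule φ) (LoopIrred.hwv φ) := by
  let G : k[T;T⁻¹] →ₗ[k] LoopModule k (LoopIrred φ) :=
    (TensorProduct.mk k k[T;T⁻¹] (LoopIrred φ)).flip (LoopIrred.hwv φ)
  let F : hMod φ →ₗ[k] LoopModule k (LoopIrred φ) := G ∘ₗ (hMod φ).toSubmodule.subtype
  refine Ind.exists_lift F fun b n => ?_
  have key : ∀ p : k[T;T⁻¹], LoopModule.mk (laurentAct φ b p) (LoopIrred.hwv φ) =
      ⁅(b : Affine k), LoopModule.mk p (LoopIrred.hwv φ)⁆ := fun p => by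
    rw [LoopModule.lie_def, loopAct_mk_hwv b.2, LoopModule.degAct_mk, laurentAct_apply,
      LoopModule.mk_add, LoopModule.mk_smul]
  exact key _

/-- The irreducible quotient of the induced module is the space of fixed vectors of `etaHat`. -/
theorem affineIrred_equiv_etaEigen_zero [CharZero k] {r : ℕ} [NeZero r]
    (hr : IsPrimitiveRoot ζ r) (hζ : ∀ m, φ m ≠ 0 → ζ ^ m = 1)
    (hmon : ∀ n : ℤ, ζ ^ n = 1 → n ∈ AddSubmonoid.closure (Function.support φ)) :
    Nonempty (AffineIrred φ ≃ₗ⁅k,Affine k⁆ etaEigen φ ζ hζ 0) := by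
  obtain ⟨g, hg⟩ := affineInd_exists_hom φ
  have hrange : ∀ m, g m ∈ etaEigen φ ζ hζ 0 := by
    have h := Ind.eq_top_of_of_mem (affineBorel k) (hMod φ) ((etaEigen φ ζ hζ 0).comap g)
      fun n => by
        change g _ ∈ etaEigen φ ζ hζ 0
        have key : ∀ p : k[T;T⁻¹], scaleHom ζ p = p → etaHat φ ζ hζ
            (LoopModule.mk p (LoopIrred.hwv φ)) = LoopModule.mk p (LoopIrred.hwv φ) :=
          fun p hp => by rw [etaHat_mk, eta_hwv, hp]
        rw [mem_etaEigen, hg, zpow_zero, Units.val_one, one_smul]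
        exact key _ (scaleHom_eq_of_mem_hMod hζ n.2)
    intro m
    have hm : m ∈ (etaEigen φ ζ hζ 0).comap g := h ▸ LieSubmodule.mem_top m
    exact hm
  let l : Ind (affineBorel k) (hMod φ) →ₗ[k] etaEigen φ ζ hζ 0 :=
    LinearMap.codRestrict (etaEigen φ ζ hζ 0).toSubmodule
      (g : Ind (affineBorel k) (hMod φ) →ₗ[k] LoopModule k (LoopIrred φ)) hrange
  let g₀ : Ind (affineBorel k) (hMod φ) →ₗ⁅k,Affine k⁆ etaEigen φ ζ hζ 0 :=
    { l with
      map_lie' := fun {x m} => Subtype.ext (LieModuleHom.map_lie g x m) }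
  -- The generator 1 is sent to v ⊗ 1 ≠ 0. This shows both that H(φ) has non-zero image in the
  -- induced module and that the homomorphism is non-zero.
  let one : hMod φ := ⟨(1 : k[T;T⁻¹]), LieSubmodule.subset_lieSpan rfl⟩
  have hone : g (Ind.of (affineBorel k) (hMod φ) one) ≠ 0 := by
    rw [hg]
    change LoopModule.mk (1 : k[T;T⁻¹]) _ ≠ 0
    rw [← LaurentPolynomial.T_zero]
    exact hwvT_ne_zero φ 0
  have := etaEigen_isIrreducible hζ hr hmon 0
  refine irredQuot_equiv (affineInd_properSum_ne_top hζ hmon fun h => hone ?_) g₀ fun h => hone ?_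
  · rw [h, LinearMap.zero_apply, map_zero]
  · exact congrArg Subtype.val (LieModuleHom.congr_fun h (Ind.of (affineBorel k) (hMod φ) one))

theorem etaHat_mulT (hζ : ∀ m, φ m ≠ 0 → ζ ^ m = 1) (i : ℤ) (w : LoopModule k (LoopIrred φ)) :
    etaHat φ ζ hζ (LoopModule.mulT i w) =
      ((ζ ^ i : kˣ) : k) • LoopModule.mulT i (etaHat φ ζ hζ w) := by
  induction w using LoopModule.induction with
  | h0 => simp
  | hadd v w hv hw => simp only [map_add, hv, hw, smul_add]
  | hmk n u =>
    rw [LoopModule.mulT_mk, etaHat_mk_T, etaHat_mk_T, map_smul, LoopModule.mulT_mk, smul_smul,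
      zpow_add, Units.val_mul]

theorem mulT_mem_etaEigen (hζ : ∀ m, φ m ≠ 0 → ζ ^ m = 1) (i j : ℤ)
    {w : LoopModule k (LoopIrred φ)} (hw : w ∈ etaEigen φ ζ hζ j) :
    LoopModule.mulT i w ∈ etaEigen φ ζ hζ (i + j) := by
  rw [mem_etaEigen] at hw ⊢
  rw [etaHat_mulT, hw, map_smul, smul_smul, zpow_add, Units.val_mul]

/-- Multiplication by `t ^ (-i)`, as a map from an eigenspace of `etaHat` to the space of fixed
vectors. -/
def untwist (hζ : ∀ m, φ m ≠ 0 → ζ ^ m = 1) (i : ℤ) :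
    etaEigen φ ζ hζ i ≃ₗ[k] etaEigen φ ζ hζ 0 where
  toFun w := ⟨LoopModule.mulT (-i) w, by
    have h := mulT_mem_etaEigen hζ (-i) i w.2
    rwa [neg_add_cancel] at h⟩
  invFun w := ⟨LoopModule.mulT i w, by
    have h := mulT_mem_etaEigen hζ i 0 w.2
    rwa [add_zero] at h⟩
  map_add' v w := Subtype.ext (map_add (LoopModule.mulT (-i)) _ _)
  map_smul' c w := Subtype.ext (map_smul (LoopModule.mulT (-i)) _ _)
  left_inv w := Subtype.ext (LoopModule.mulT_mulT _ _ (add_neg_cancel i) _)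
  right_inv w := Subtype.ext (LoopModule.mulT_mulT _ _ (neg_add_cancel i) _)

/-- This is `lie_mulT` for -i with the correction moved to the other side, which turns -i into i. -/
theorem untwist_lie (hζ : ∀ m, φ m ≠ 0 → ζ ^ m = 1) (i : ℤ) (x : Affine k)
    (w : etaEigen φ ζ hζ i) :
    untwist hζ i ⁅x, w⁆ = ⁅x, untwist hζ i w⁆ + (Affine.deg x * i) • untwist hζ i w := by
  refine Subtype.ext ?_
  change LoopModule.mulT (-i) ⁅x, (w : LoopModule k (LoopIrred φ))⁆ =
    ⁅x, LoopModule.mulT (-i) (w : LoopModule k (LoopIrred φ))⁆ +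
      (Affine.deg x * i) • LoopModule.mulT (-i) (w : LoopModule k (LoopIrred φ))
  rw [LoopModule.lie_mulT, Int.cast_neg, mul_neg, neg_smul, neg_add_cancel_right]

/-- Multiplication by t^(-i) leads to the fixed vectors, a copy of L̃(φ). The defect `deg x * i` in
`untwist_lie` is the second term of the action on a tensor product with k_i. -/
theorem etaEigen_equiv [CharZero k] {r : ℕ} [NeZero r]
    (hr : IsPrimitiveRoot ζ r) (hζ : ∀ m, φ m ≠ 0 → ζ ^ m = 1)
    (hmon : ∀ n : ℤ, ζ ^ n = 1 → n ∈ AddSubmonoid.closure (Function.support φ)) (i : ℤ) :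
    Nonempty (etaEigen φ ζ hζ i ≃ₗ⁅k,Affine k⁆ AffineIrred φ ⊗[k] OneDim (i : k)) := by
  obtain ⟨e⟩ := affineIrred_equiv_etaEigen_zero hr hζ hmon
  let ρ : AffineIrred φ ≃ₗ[k] AffineIrred φ ⊗[k] OneDim (i : k) :=
    (TensorProduct.rid k (AffineIrred φ)).symm
  have hρ : ∀ a, ρ a = a ⊗ₜ[k] (show OneDim (i : k) from (1 : k)) := fun a => rfl
  let Ψ := ((untwist hζ i).trans e.symm.toLinearEquiv).trans ρ
  have hΨ : ∀ w, Ψ w = ρ (e.symm (untwist hζ i w)) := fun w => rfl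
  exact ⟨{ Ψ with
    map_lie' := by
      intro x w
      change Ψ ⁅x, w⁆ = ⁅x, Ψ w⁆
      rw [hΨ, hΨ, untwist_lie, map_add, map_smul, map_add, map_smul, hρ, hρ,
        TensorProduct.LieModule.lie_tmul_right, OneDim.lie_def, TensorProduct.tmul_smul]
      congr 2
      exact LieModuleHom.map_lie e.symm.toLieModuleHom x _ }⟩

end AffineInduced

end

end LoopSl2

/-! ### The main theorem -/

open LoopSl2 in
theorem mainTheorem3 {k : Type*} [Field k] [IsAlgClosed k] [CharZero k] (φ : ℤ → k)
    (hφ : φ ∈ expPoly k) (hφ0 : φ ≠ 0) (ζ : kˣ) (hζ : IsPrimitiveRoot ζ (degree φ)) :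
    -- `etaHat` is an automorphism of the module, of order `r = degree φ`
    ((∃ e : LoopModule k (LoopIrred φ) ≃ₗ⁅k, Affine k⁆ LoopModule k (LoopIrred φ),
        ∀ w, e w = etaHat φ ζ (rootCond hφ hφ0 hζ) w) ∧
      orderOf (etaHat φ ζ (rootCond hφ hφ0 hζ)) = degree φ) ∧
    -- the loop module is the direct sum of the eigenspaces of `etaHat`
    (DirectSum.IsInternal fun i : ZMod (degree φ) =>
      (etaHat φ ζ (rootCond hφ hφ0 hζ)).eigenspace ((ζ ^ i.val : kˣ) : k)) ∧
    -- each eigenspace of `etaHat` is a direct sum of spaces `(eigenspace of eta) ⊗ t ^ m`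
    (∀ i : ℤ,
      iSupIndep (fun m : ℤ =>
        ((eta φ ζ (rootCond hφ hφ0 hζ)).eigenspace ((ζ ^ (i - m) : kˣ) : k)).map
          (LoopModule.mk (LaurentPolynomial.T m))) ∧
      (etaHat φ ζ (rootCond hφ hφ0 hζ)).eigenspace ((ζ ^ i : kˣ) : k) =
        ⨆ m : ℤ, ((eta φ ζ (rootCond hφ hφ0 hζ)).eigenspace ((ζ ^ (i - m) : kˣ) : k)).map
          (LoopModule.mk (LaurentPolynomial.T m))) ∧
    -- each eigenspace of `etaHat` is an irreducible submodule, isomorphic to a twist of `L̃(φ)`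
    (∀ i : ℤ, ∃ N : LieSubmodule k (Affine k) (LoopModule k (LoopIrred φ)),
      N.toSubmodule = (etaHat φ ζ (rootCond hφ hφ0 hζ)).eigenspace ((ζ ^ i : kˣ) : k) ∧
      Nonempty (N ≃ₗ⁅k, Affine k⁆ AffineIrred φ ⊗[k] OneDim (i : k)) ∧
      LieModule.IsIrreducible k (Affine k) N) := by
  have hc := rootCond hφ hφ0 hζ
  obtain ⟨hpos, hclosure⟩ := degree_spec hφ hφ0
  have : NeZero (degree φ) := ⟨hpos.ne'⟩
  have hmon : ∀ n : ℤ, ζ ^ n = 1 → n ∈ AddSubmonoid.closure (Function.support φ) := by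
    intro n hn
    rw [hclosure]
    exact Int.mem_zmultiples_iff.2 ((hζ.zpow_eq_one_iff_dvd n).1 hn)
  have hsup : ⨆ j : ZMod (degree φ), (etaHat φ ζ hc).eigenspace ((ζ ^ j.val : kˣ) : k) = ⊤ := by
    have h := congrArg LieSubmodule.toSubmodule (iSup_etaEigen hc hζ hmon)
    rw [LieSubmodule.iSup_toSubmodule] at h
    refine (iSup_congr fun j => ?_).trans h
    change _ = (etaHat φ ζ hc).eigenspace ((ζ ^ (j.val : ℤ) : kˣ) : k)
    rw [zpow_natCast]
  have hpow : ∀ (n : ℕ) (μ : k) w, etaHat φ ζ hc w = μ • w → (etaHat φ ζ hc ^ n) w = μ ^ n • w := by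
    intro n μ w hw
    induction n with
    | zero => rw [pow_zero, pow_zero, one_smul, Module.End.one_apply]
    | succ n ih => rw [pow_succ, Module.End.mul_apply, hw, map_smul, ih, smul_smul, pow_succ']
  -- The eigenspaces span, and each eigenvalue is an r-th root of unity.
  have hpow1 : etaHat φ ζ hc ^ degree φ = 1 := by
    refine LinearMap.ext fun w => ?_
    have hw : w ∈ ⨆ j : ZMod (degree φ),
        (etaHat φ ζ hc).eigenspace ((ζ ^ j.val : kˣ) : k) := hsup ▸ Submodule.mem_top
    induction hw using Submodule.iSup_induction' with
    | zero => rw [map_zero, map_zero]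
    | add a b _ _ ha hb => rw [map_add, map_add, ha, hb]
    | mem j w hw =>
      rw [hpow _ _ _ (Module.End.mem_eigenspace_iff.1 hw), ← Units.val_pow_eq_pow_val, ← pow_mul,
        mul_comm, pow_mul, hζ.pow_eq_one, one_pow, Units.val_one, one_smul, Module.End.one_apply]
  refine ⟨⟨?_, ?_⟩, ?_, fun i => ⟨?_, ?_⟩, fun i => ⟨etaEigen φ ζ hc i, rfl,
    etaEigen_equiv hζ hc hmon i, etaEigen_isIrreducible hc hζ hmon i⟩⟩
  -- With r = n + 1, the inverse of η̂ is its n-th power.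
  · obtain ⟨n, hn⟩ : ∃ n, degree φ = n + 1 := ⟨degree φ - 1, by omega⟩
    refine ⟨{
      toLinearMap := etaHat φ ζ hc
      map_lie' := fun {x w} => etaHat_lie φ ζ hc x w
      invFun := ⇑(etaHat φ ζ hc ^ n : Module.End k (LoopModule k (LoopIrred φ)))
      left_inv := fun w => ?_
      right_inv := fun w => ?_ }, fun w => rfl⟩
    · have := LinearMap.congr_fun hpow1 w
      rwa [hn, pow_succ] at this
    · have := LinearMap.congr_fun hpow1 w
      rwa [hn, pow_succ'] at this
  · refine Nat.dvd_antisymm (orderOf_dvd_of_pow_eq_one hpow1) (hζ.dvd_of_pow_eq_one _ ?_)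
    -- The vector v ⊗ t has eigenvalue ζ, so the order of η̂ is a multiple of the order r of ζ.
    have h1 := hpow (orderOf (etaHat φ ζ hc)) _ _ (etaHat_hwvT φ ζ hc 1)
    rw [pow_orderOf_eq_one, Module.End.one_apply, zpow_one, ← sub_eq_zero] at h1
    nth_rw 1 [← one_smul k (hwvT φ 1)] at h1
    rw [← sub_smul, smul_eq_zero, sub_eq_zero] at h1
    refine Units.ext ?_
    rw [Units.val_pow_eq_pow_val, Units.val_one]
    exact (h1.resolve_right (hwvT_ne_zero φ 1)).symm
  · refine DirectSum.isInternal_submodule_of_iSupIndep_of_iSup_eq_top ?_ hsup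
    exact (Module.End.eigenspaces_iSupIndep (etaHat φ ζ hc)).comp (zpow_val_injective hζ)
  -- The m-th summand lies in the eigenspace of the degree operator for m, and these eigenvalues are
  -- distinct in characteristic zero.
  · refine ((Module.End.eigenspaces_iSupIndep (LoopModule.degAct (k := k)
      (M := LoopIrred φ))).comp (Int.cast_injective (α := k))).mono fun m => ?_
    rintro _ ⟨u, -, rfl⟩
    exact Module.End.mem_eigenspace_iff.2 (LoopModule.degAct_mk_T m u)
  -- On u ⊗ t^m the map η̂ is η on u times ζ^m, so the eigenvalue ζ^i for η̂ means ζ^(i-m) for η.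
  · have hiff : ∀ m u, LoopModule.mk (LaurentPolynomial.T m) u ∈
        (etaHat φ ζ hc).eigenspace ((ζ ^ i : kˣ) : k) ↔
        u ∈ (eta φ ζ hc).eigenspace ((ζ ^ (i - m) : kˣ) : k) := by
      intro m u
      rw [Module.End.mem_eigenspace_iff, Module.End.mem_eigenspace_iff, etaHat_mk_T,
        ← (LoopModule.mk (LaurentPolynomial.T m)).map_smul,
        ← (LoopModule.mk (LaurentPolynomial.T m)).map_smul, (LoopModule.mk_T_injective m).eq_iff, zpow_sub, Units.val_mul, mul_comm,
        mul_smul, Units.val_inv_eq_inv_val, eq_inv_smul_iff₀ (Units.ne_zero _)]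
    refine le_antisymm (fun w hw => ?_) (iSup_le fun m => ?_)
    · obtain ⟨f, rfl⟩ := LoopModule.exists_eq_sum w
      refine Submodule.sum_mem _ fun m _ => Submodule.mem_iSup_of_mem m ⟨f m, ?_, rfl⟩
      -- The eigenspace is stable under d, hence graded, so it contains each homogeneous component
      -- of w.
      refine (hiff m (f m)).1 (LoopModule.mk_mem_of_sum_mem (fun w hw => ?_) hw m)
      rw [← LoopModule.d_lie]
      exact (etaEigen φ ζ hc i).lie_mem hw
    · rintro _ ⟨u, hu, rfl⟩
      exact (hiff m u).2 hu
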